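/- All C*-algebras are complex and not assumed unital, and $A\otimes B$ denotes the spatial (minimal) tensor product. **Definitions.** A *correspondence* over a C*-algebra $A$ is a right Hilbert $A$-module $X$ (with $A$-valued inner product $\langle\cdot,\cdot\rangle$, linear in the second variable) together with a $*$-homomorphism $\phi_X$ from $A$ to the adjointable operators on $X$; it is not assumed to be injective or nondegenerate. The compact operators $\mathcal K(X)$ are the closed linear span of the operators $z\mapsto x\cdot\langle y,z\rangle$ with $x,y\in X$, and the *Katsura ideal* of $X$ is $$J_X=\{a\in A:\ \phi_X(a)\in\mathcal K(X)\ \text{and}\ ab=0\ \text{for all}\ b\in\ker\phi_X\}.$$ If $X$ and $Y$ are correspondences over $A$ and $B$, their *external tensor product* $X\otimes Y$ is the correspondence over $A\otimes B$ obtained by completing the algebraic tensor product of $X$ and $Y$ with respect to the $A\otimes B$-valued inner product $\langle x\otimes y,x'\otimes y'\rangle=\langle x,x'\rangle\otimes\langle y,y'\rangle$, with the actions $(x\otimes y)\cdot(a\otimes b)=(x\cdot a)\otimes(y\cdot b)$ and $\phi_{X\otimes Y}(a\otimes b)(x\otimes y)=\phi_X(a)x\otimes\phi_Y(b)y$. For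 closed subspaces $C\subseteq A$ and $D\subseteq B$, $C\otimes D\subseteq A\otimes B$ is the closed linear span of the elements $c\otimes d$ with $c\in C$, $d\in D$. The correspondences $X$ and $Y$ are *ideal-compatible* if $J_{X\otimes Y}=J_X\otimes J_Y$. For a closed subalgebra $C\subseteq A$, the triple $(C,A,B)$ has the *slice map property* if $$C\otimes B=\{x\in A\otimes B:\ (\mathrm{id}_A\otimes\omega)(x)\in C\ \text{for all}\ \omega\in B^*\},$$ where $\mathrm{id}_A\otimes\omega:A\otimes B\to A$ is the bounded linear map with $a\otimes b\mapsto\omega(b)a$. A correspondence $Y$ over $B$ is an *imprimitivity bimodule* if it is full as a right Hilbert $B$-module and, with its left action, also carries a $B$-valued inner product ${}_B\langle\cdot,\cdot\rangle$ that makes it a full left Hilbert $B$-module and satisfies ${}_B\langle x,y\cdot b\rangle={}_B\langle x\cdot b^*,y\rangle$ and ${}_B\langle x,y\rangle\cdot z=x\cdot\langle y,z\rangle$ for all $x,y,z\in Y$, $b\in B$. **Lemma.** Let $X$ and $Y$ be correspondences over C*-algebras $A$ and $B$, and suppose that $Y$ is an imprimitivity bimodule. If $(J_X,A,B)$ has the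 slice map property, then $X$ and $Y$ are ideal-compatible, i.e. $J_{X\otimes Y}=J_X\otimes J_Y$, and moreover $J_{X\otimes Y}=J_X\otimes B$. -/

import Mathlib

open scoped TensorProduct InnerProductSpace ComplexConjugate

universe u v

noncomputable section

namespace CStarCorrespondence

open UniformSpace

/-! ### Hilbert modules and correspondences -/

/-- A right Hilbert module `X` over a C⋆-algebra `A`: `act a x` is `x · a` and `ip x y` is the
`A`-valued inner product `⟨x, y⟩`, conjugate linear in `x` and linear in `y`. The norm of `X` is
the norm `‖⟨x, x⟩‖ ^ (1 / 2)`, and `X` is complete. Positivity of `⟨x, x⟩` is expressed by its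
being of the form `b⋆ b`; definiteness of the inner product is contained in `norm_sq`. -/
class HilbertModule (A X : Type*) [NonUnitalCStarAlgebra A] [NormedAddCommGroup X]
    [NormedSpace ℂ X] [CompleteSpace X] where
  act : A →ₗ[ℂ] X →ₗ[ℂ] X
  ip : X →ₗ⋆[ℂ] X →ₗ[ℂ] A
  act_mul : ∀ (a b : A) (x : X), act (a * b) x = act b (act a x)
  ip_self : ∀ x : X, ∃ b : A, ip x x = star b * b
  star_ip : ∀ x y : X, star (ip x y) = ip y x
  ip_act : ∀ (x y : X) (a : A), ip x (act a y) = ip x y * a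
  norm_sq : ∀ x : X, ‖x‖ ^ 2 = ‖ip x x‖

/-- A C⋆-correspondence over `A`: a right Hilbert `A`-module `X` with a left action of `A` by
adjointable operators, i.e. a homomorphism `φ` such that `φ (a⋆)` is an adjoint of `φ a`. -/
class Correspondence (A X : Type*) [NonUnitalCStarAlgebra A] [NormedAddCommGroup X]
    [NormedSpace ℂ X] [CompleteSpace X] extends HilbertModule A X where
  φ : A →ₙₐ[ℂ] (X →L[ℂ] X)
  ip_φ : ∀ (a : A) (x y : X), ip (φ a x) y = ip x (φ (star a) y)

/-! ### Extending bounded bilinear maps to completions -/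

section Extend

variable {E F G : Type*} [SeminormedAddCommGroup E] [NormedSpace ℂ E]
  [SeminormedAddCommGroup F] [NormedSpace ℂ F] [SeminormedAddCommGroup G] [NormedSpace ℂ G]
  {σ : ℂ →+* ℂ}

theorem norm_completion_le (g : F →L[ℂ] G) {C : ℝ} (hC : 0 ≤ C) (h : ∀ y, ‖g y‖ ≤ C * ‖y‖) :
    ‖g.completion‖ ≤ C := by
  refine ContinuousLinearMap.opNorm_le_bound _ hC fun y => ?_
  induction y using Completion.induction_on with
  | hp => exact isClosed_le (by fun_prop) (by fun_prop)
  | ih y => simpa using h y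

/-- The linear map sending `x` to the extension of `f x` to the completions. -/
def extendAux (f : E →ₛₗ[σ] F →ₗ[ℂ] G) (C : ℝ) (hf : ∀ x y, ‖f x y‖ ≤ C * ‖x‖ * ‖y‖) :
    E →ₛₗ[σ] (Completion F →L[ℂ] Completion G) where
  toFun x := ((f x).mkContinuous (C * ‖x‖) (hf x)).completion
  map_add' x y := by
    refine DFunLike.coe_injective (Completion.ext (ContinuousLinearMap.continuous _)
      (ContinuousLinearMap.continuous _) fun z => ?_)
    rw [add_apply, ContinuousLinearMap.completion_apply_coe,
      ContinuousLinearMap.completion_apply_coe, ContinuousLinearMap.completion_apply_coe,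
      ← Completion.coe_add]
    simp only [LinearMap.mkContinuous_apply, map_add, LinearMap.add_apply]
  map_smul' c x := by
    refine DFunLike.coe_injective (Completion.ext (ContinuousLinearMap.continuous _)
      (ContinuousLinearMap.continuous _) fun z => ?_)
    rw [smul_apply, ContinuousLinearMap.completion_apply_coe,
      ContinuousLinearMap.completion_apply_coe, ← Completion.coe_smul]
    simp only [LinearMap.mkContinuous_apply, map_smulₛₗ, LinearMap.smul_apply]

/-- The unique continuous extension to completions of a bounded sesquilinear or bilinear map. -/
def extendBilin (f : E →ₛₗ[σ] F →ₗ[ℂ] G) (C : ℝ) (hf : ∀ x y, ‖f x y‖ ≤ C * ‖x‖ * ‖y‖) :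
    Completion E →SL[σ] Completion F →L[ℂ] Completion G :=
  ((extendAux f C hf).mkContinuous |C| fun x => by
    refine norm_completion_le _ (by positivity) fun y => (hf x y).trans ?_
    gcongr
    exact le_abs_self C).fromCompletion

@[simp]
theorem extendBilin_coe (f : E →ₛₗ[σ] F →ₗ[ℂ] G) (C : ℝ)
    (hf : ∀ x y, ‖f x y‖ ≤ C * ‖x‖ * ‖y‖) (x : E) (y : F) :
    extendBilin f C hf (x : Completion E) (y : Completion F) = (f x y : Completion G) := by
  simp [extendBilin, extendAux]

theorem continuous_extendBilin (f : E →ₛₗ[σ] F →ₗ[ℂ] G) (C : ℝ)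
    (hf : ∀ x y, ‖f x y‖ ≤ C * ‖x‖ * ‖y‖) {T : Type*} [TopologicalSpace T]
    {g : T → Completion E} {h : T → Completion F} (hg : Continuous g) (hh : Continuous h) :
    Continuous fun t => extendBilin f C hf (g t) (h t) :=
  ((extendBilin f C hf).continuous.comp hg).clm_apply hh

end Extend

/-! ### The spatial tensor product of C⋆-algebras -/

/-- A representation of a C⋆-algebra on a Hilbert space. -/
structure HilbertRep (A : Type u) [NonUnitalCStarAlgebra A] where
  H : Type u
  [grp : NormedAddCommGroup H]
  [ips : InnerProductSpace ℂ H]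
  [cpl : CompleteSpace H]
  rep : A →⋆ₙₐ[ℂ] (H →L[ℂ] H)

attribute [instance] HilbertRep.grp HilbertRep.ips HilbertRep.cpl

section Spatial

variable {A : Type u} {B : Type v} [NonUnitalCStarAlgebra A] [NonUnitalCStarAlgebra B]

theorem HilbertRep.norm_rep_le (π : HilbertRep A) (a : A) : ‖π.rep a‖ ≤ ‖a‖ :=
  NonUnitalStarAlgHom.norm_apply_le π.rep a

theorem HilbertRep.inner_rep (π : HilbertRep A) (a : A) (x y : π.H) :
    ⟪x, π.rep (star a) y⟫_ℂ = ⟪π.rep a x, y⟫_ℂ := by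
  rw [map_star, ContinuousLinearMap.star_eq_adjoint, ContinuousLinearMap.adjoint_inner_right]

/-- The tensor product `π ⊗ ρ` of two representations, on the algebraic tensor product of `A`
and `B`, by bounded operators on the algebraic tensor product of the two Hilbert spaces. -/
def HilbertRep.tensor (π : HilbertRep A) (ρ : HilbertRep B) :
    A ⊗[ℂ] B →ₗ[ℂ] (π.H ⊗[ℂ] ρ.H →L[ℂ] π.H ⊗[ℂ] ρ.H) :=
  TensorProduct.lift <| LinearMap.mk₂ ℂ (fun a b => TensorProduct.mapL (π.rep a) (ρ.rep b))
    (fun a a' b => by rw [map_add, TensorProduct.mapL_add_left])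
    (fun c a b => by rw [map_smul, TensorProduct.mapL_smul_left])
    (fun a b b' => by rw [map_add, TensorProduct.mapL_add_right])
    (fun c a b => by rw [map_smul, TensorProduct.mapL_smul_right])

@[simp]
theorem HilbertRep.tensor_tmul (π : HilbertRep A) (ρ : HilbertRep B) (a : A) (b : B) :
    π.tensor ρ (a ⊗ₜ b) = TensorProduct.mapL (π.rep a) (ρ.rep b) := rfl

variable (A B) in
/-- The multiplication of the algebraic tensor product. -/
def mulT : A ⊗[ℂ] B →ₗ[ℂ] A ⊗[ℂ] B →ₗ[ℂ] A ⊗[ℂ] B :=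
  TensorProduct.map₂ (LinearMap.mul ℂ A) (LinearMap.mul ℂ B)

variable (A B) in
/-- The involution of the algebraic tensor product. -/
def starT : A ⊗[ℂ] B →ₗ⋆[ℂ] A ⊗[ℂ] B :=
  TensorProduct.map (starLinearEquiv ℂ : A ≃ₗ⋆[ℂ] A).toLinearMap
    (starLinearEquiv ℂ : B ≃ₗ⋆[ℂ] B).toLinearMap

@[simp]
theorem mulT_tmul (a a' : A) (b b' : B) :
    mulT A B (a ⊗ₜ b) (a' ⊗ₜ b') = (a * a') ⊗ₜ (b * b') := rfl

@[simp]
theorem starT_tmul (a : A) (b : B) : starT A B (a ⊗ₜ b) = star a ⊗ₜ star b := rfl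

theorem mulT_assoc (r s t : A ⊗[ℂ] B) :
    mulT A B (mulT A B r s) t = mulT A B r (mulT A B s t) := by
  induction r using TensorProduct.induction_on with
  | zero => simp
  | add r r' h h' => simp [h, h']
  | tmul a b =>
    induction s using TensorProduct.induction_on with
    | zero => simp
    | add s s' h h' => simp [h, h']
    | tmul a' b' =>
      induction t using TensorProduct.induction_on with
      | zero => simp
      | add t t' h h' => simp only [map_add, h, h']
      | tmul a'' b'' => simp [mul_assoc]

theorem starT_starT (t : A ⊗[ℂ] B) : starT A B (starT A B t) = t := by
  induction t using TensorProduct.induction_on with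
  | zero => simp
  | add t t' h h' => simp [h, h']
  | tmul a b => simp

theorem starT_mulT (s t : A ⊗[ℂ] B) :
    starT A B (mulT A B s t) = mulT A B (starT A B t) (starT A B s) := by
  induction s using TensorProduct.induction_on with
  | zero => simp
  | add s s' h h' => simp [h, h']
  | tmul a' b' =>
    induction t using TensorProduct.induction_on with
    | zero => simp
    | add t t' h h' => simp [h, h']
    | tmul a'' b'' => simp

theorem HilbertRep.tensor_mulT (π : HilbertRep A) (ρ : HilbertRep B) (s t : A ⊗[ℂ] B) :
    π.tensor ρ (mulT A B s t) = π.tensor ρ s ∘L π.tensor ρ t := by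
  induction s using TensorProduct.induction_on with
  | zero => simp
  | add s s' h h' => simp [h, h']
  | tmul a' b' =>
    induction t using TensorProduct.induction_on with
    | zero => simp
    | add t t' h h' => simp [h, h']
    | tmul a'' b'' =>
      rw [mulT_tmul, tensor_tmul, map_mul, map_mul, TensorProduct.mapL_mul]; rfl

theorem HilbertRep.inner_tensor (π : HilbertRep A) (ρ : HilbertRep B) (t : A ⊗[ℂ] B)
    (ξ η : π.H ⊗[ℂ] ρ.H) :
    ⟪ξ, π.tensor ρ (starT A B t) η⟫_ℂ = ⟪π.tensor ρ t ξ, η⟫_ℂ := by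
  induction t using TensorProduct.induction_on with
  | zero => simp
  | add s s' h h' => simp [inner_add_left, inner_add_right, h, h']
  | tmul a b =>
    induction ξ using TensorProduct.induction_on with
    | zero => simp
    | add s s' h h' => simp only [inner_add_left, map_add, h, h']
    | tmul x y =>
      induction η using TensorProduct.induction_on with
      | zero => simp
      | add s s' h h' => simp only [inner_add_right, map_add, h, h']
      | tmul x' y' =>
        rw [starT_tmul, tensor_tmul, tensor_tmul, TensorProduct.mapL_tmul,
          TensorProduct.mapL_tmul, TensorProduct.inner_tmul, TensorProduct.inner_tmul,
          inner_rep, inner_rep]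

theorem HilbertRep.exists_norm_tensor_le (t : A ⊗[ℂ] B) :
    ∃ C : ℝ, ∀ (π : HilbertRep A) (ρ : HilbertRep B), ‖π.tensor ρ t‖ ≤ C := by
  induction t using TensorProduct.induction_on with
  | zero => exact ⟨0, fun π ρ => by rw [map_zero]; exact ContinuousLinearMap.opNorm_zero.le⟩
  | add s t hs ht =>
    obtain ⟨C, hC⟩ := hs
    obtain ⟨D, hD⟩ := ht
    refine ⟨C + D, fun π ρ => ?_⟩
    rw [map_add]
    exact (norm_add_le (π.tensor ρ s) (π.tensor ρ t)).trans (add_le_add (hC π ρ) (hD π ρ))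
  | tmul a b =>
    refine ⟨‖a‖ * ‖b‖, fun π ρ => ?_⟩
    rw [tensor_tmul]
    refine (TensorProduct.norm_mapL_le _ _).trans ?_
    gcongr
    · exact π.norm_rep_le a
    · exact ρ.norm_rep_le b

variable (A) in
/-- The representation on the zero space. -/
def HilbertRep.zero : HilbertRep A where
  H := PUnit
  rep := 0

instance : Nonempty (HilbertRep A) := ⟨.zero A⟩

/-- The spatial (minimal) norm of the algebraic tensor product: the supremum of the norms
`‖(π ⊗ ρ)(t)‖` over all Hilbert space representations `π` of `A` and `ρ` of `B`. -/
def spatialNorm (t : A ⊗[ℂ] B) : ℝ :=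
  ⨆ p : HilbertRep A × HilbertRep B, ‖p.1.tensor p.2 t‖

theorem norm_tensor_le (π : HilbertRep A) (ρ : HilbertRep B) (t : A ⊗[ℂ] B) :
    ‖π.tensor ρ t‖ ≤ spatialNorm t := by
  obtain ⟨C, hC⟩ := HilbertRep.exists_norm_tensor_le t
  exact le_ciSup (f := fun p : HilbertRep A × HilbertRep B => ‖p.1.tensor p.2 t‖)
    ⟨C, by rintro _ ⟨p, rfl⟩; exact hC p.1 p.2⟩ (π, ρ)

theorem spatialNorm_le {t : A ⊗[ℂ] B} {C : ℝ}
    (h : ∀ (π : HilbertRep A) (ρ : HilbertRep B), ‖π.tensor ρ t‖ ≤ C) : spatialNorm t ≤ C :=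
  ciSup_le fun p => h p.1 p.2

theorem spatialNorm_nonneg (t : A ⊗[ℂ] B) : 0 ≤ spatialNorm t :=
  (norm_nonneg ((HilbertRep.zero A).tensor (.zero B) t)).trans (norm_tensor_le (.zero A) (.zero B) t)

variable (A B) in
/-- The spatial norm as a seminorm. -/
def spatialSeminorm : Seminorm ℂ (A ⊗[ℂ] B) :=
  Seminorm.ofSMulLE spatialNorm
    (le_antisymm (spatialNorm_le fun π ρ => by
      rw [map_zero]; exact ContinuousLinearMap.opNorm_zero.le) (spatialNorm_nonneg _))
    (fun s t => spatialNorm_le fun π ρ => by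
      rw [map_add]
      exact (norm_add_le (π.tensor ρ s) (π.tensor ρ t)).trans
        (add_le_add (norm_tensor_le π ρ s) (norm_tensor_le π ρ t)))
    (fun c t => spatialNorm_le fun π ρ => by
      rw [map_smul]
      exact (ContinuousLinearMap.opNorm_smul_le c (π.tensor ρ t)).trans
        (mul_le_mul_of_nonneg_left (norm_tensor_le π ρ t) (norm_nonneg c)))

theorem spatialNorm_tmul_le (a : A) (b : B) : spatialNorm (a ⊗ₜ[ℂ] b) ≤ ‖a‖ * ‖b‖ :=
  spatialNorm_le fun π ρ => by
    rw [HilbertRep.tensor_tmul]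
    refine (TensorProduct.norm_mapL_le _ _).trans ?_
    gcongr
    · exact π.norm_rep_le a
    · exact ρ.norm_rep_le b

theorem spatialNorm_mulT_le (s t : A ⊗[ℂ] B) :
    spatialNorm (mulT A B s t) ≤ spatialNorm s * spatialNorm t :=
  spatialNorm_le fun π ρ => by
    rw [HilbertRep.tensor_mulT]
    refine (ContinuousLinearMap.opNorm_comp_le _ _).trans ?_
    exact mul_le_mul (norm_tensor_le π ρ s) (norm_tensor_le π ρ t) (norm_nonneg _)
      (spatialNorm_nonneg s)

theorem spatialNorm_sq_le (t : A ⊗[ℂ] B) :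
    spatialNorm t * spatialNorm t ≤ spatialNorm (mulT A B (starT A B t) t) := by
  rw [← sq]
  refine (Real.le_sqrt (spatialNorm_nonneg _) (spatialNorm_nonneg _)).1 ?_
  refine spatialNorm_le fun π ρ => ?_
  refine ContinuousLinearMap.opNorm_le_bound _ (Real.sqrt_nonneg _) fun ξ => ?_
  refine le_of_sq_le_sq ?_ (by positivity)
  rw [mul_pow, Real.sq_sqrt (spatialNorm_nonneg _), ← inner_self_eq_norm_sq (𝕜 := ℂ),
    ← HilbertRep.inner_tensor, ← ContinuousLinearMap.comp_apply, ← HilbertRep.tensor_mulT]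
  refine (Complex.re_le_norm _).trans ((norm_inner_le_norm ξ
    (π.tensor ρ (mulT A B (starT A B t) t) ξ)).trans ?_)
  have := ((π.tensor ρ (mulT A B (starT A B t) t)).le_opNorm ξ).trans
    (mul_le_mul_of_nonneg_right (norm_tensor_le π ρ _) (norm_nonneg ξ))
  nlinarith [norm_nonneg ξ]

theorem spatialNorm_starT (t : A ⊗[ℂ] B) : spatialNorm (starT A B t) = spatialNorm t := by
  have key : ∀ s : A ⊗[ℂ] B, spatialNorm s ≤ spatialNorm (starT A B s) := fun s => by
    have h := (spatialNorm_sq_le s).trans (spatialNorm_mulT_le _ _)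
    rcases (spatialNorm_nonneg s).eq_or_lt with h0 | h0
    · rw [← h0]; exact spatialNorm_nonneg _
    · exact le_of_mul_le_mul_right h h0
  refine le_antisymm ?_ (key t)
  simpa [starT_starT] using key (starT A B t)

end Spatial

/-- The algebraic tensor product with the spatial norm. -/
def AlgTensor (A : Type u) (B : Type v) [NonUnitalCStarAlgebra A] [NonUnitalCStarAlgebra B] :
    Type (max u v) := A ⊗[ℂ] B

section CStarTensor

variable (A : Type u) (B : Type v) [NonUnitalCStarAlgebra A] [NonUnitalCStarAlgebra B]

instance : SeminormedAddCommGroup (AlgTensor A B) :=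
  (spatialSeminorm A B).toAddGroupSeminorm.toSeminormedAddCommGroup

instance : NormedSpace ℂ (AlgTensor A B) where
  __ : Module ℂ (AlgTensor A B) := inferInstanceAs (Module ℂ (A ⊗[ℂ] B))
  norm_smul_le c t := (map_smul_eq_mul (spatialSeminorm A B) c t).le

theorem norm_algTensor (t : AlgTensor A B) : ‖t‖ = spatialNorm (A := A) (B := B) t := rfl

/-- The spatial (minimal) tensor product of two C⋆-algebras. -/
def CStarTensor : Type (max u v) := Completion (AlgTensor A B)

instance : NormedAddCommGroup (CStarTensor A B) :=
  inferInstanceAs (NormedAddCommGroup (Completion (AlgTensor A B)))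

instance : NormedSpace ℂ (CStarTensor A B) :=
  inferInstanceAs (NormedSpace ℂ (Completion (AlgTensor A B)))

instance : CompleteSpace (CStarTensor A B) :=
  inferInstanceAs (CompleteSpace (Completion (AlgTensor A B)))

/-- The canonical map of the algebraic tensor product to the spatial tensor product. -/
def toTensor : A ⊗[ℂ] B →ₗ[ℂ] CStarTensor A B :=
  (Completion.toComplₗᵢ (𝕜 := ℂ) (E := AlgTensor A B)).toLinearMap

variable {A B} in
/-- The elementary tensor `a ⊗ b` in the spatial tensor product. -/
def elem (a : A) (b : B) : CStarTensor A B := toTensor A B (a ⊗ₜ b)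

theorem norm_toTensor (t : A ⊗[ℂ] B) : ‖toTensor A B t‖ = spatialNorm t :=
  Completion.norm_coe (E := AlgTensor A B) t

variable {A B} in
theorem tensor_induction {p : CStarTensor A B → Prop} (x : CStarTensor A B)
    (hp : IsClosed {x | p x}) (ih : ∀ t : A ⊗[ℂ] B, p (toTensor A B t)) : p x :=
  Completion.induction_on (α := AlgTensor A B) x hp ih

/-- The multiplication of the spatial tensor product. -/
def mulC : CStarTensor A B →L[ℂ] CStarTensor A B →L[ℂ] CStarTensor A B :=
  extendBilin (E := AlgTensor A B) (F := AlgTensor A B) (G := AlgTensor A B) (mulT A B) 1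
    fun s t => by
      change spatialNorm (mulT A B s t) ≤ 1 * spatialNorm (A := A) (B := B) s * spatialNorm t
      rw [one_mul]
      exact spatialNorm_mulT_le s t

/-- The involution of the spatial tensor product. -/
def starC : CStarTensor A B →L⋆[ℂ] CStarTensor A B :=
  ContinuousLinearMap.completion (α := AlgTensor A B) (β := AlgTensor A B)
    (LinearMap.mkContinuous (E := AlgTensor A B) (F := AlgTensor A B) (starT A B) 1
      fun t => by
        change spatialNorm (starT A B t) ≤ 1 * spatialNorm (A := A) (B := B) t
        rw [one_mul]
        exact (spatialNorm_starT t).le)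

@[simp]
theorem mulC_coe (s t : A ⊗[ℂ] B) :
    mulC A B (toTensor A B s) (toTensor A B t) = toTensor A B (mulT A B s t) :=
  extendBilin_coe (E := AlgTensor A B) (F := AlgTensor A B) (G := AlgTensor A B) _ _ _ s t

@[simp]
theorem starC_coe (t : A ⊗[ℂ] B) : starC A B (toTensor A B t) = toTensor A B (starT A B t) :=
  ContinuousLinearMap.completion_apply_coe (α := AlgTensor A B) (β := AlgTensor A B) _ t

instance : NonUnitalNormedRing (CStarTensor A B) where
  __ := (inferInstance : NormedAddCommGroup (CStarTensor A B))
  mul x y := mulC A B x y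
  left_distrib x y z := map_add (mulC A B x) y z
  right_distrib x y z := by
    change mulC A B (x + y) z = mulC A B x z + mulC A B y z
    rw [map_add, add_apply]
  zero_mul x := by
    change mulC A B 0 x = 0
    rw [map_zero, zero_apply]
  mul_zero x := map_zero (mulC A B x)
  mul_assoc x y z := by
    change mulC A B (mulC A B x y) z = mulC A B x (mulC A B y z)
    induction x using tensor_induction with
    | hp => exact isClosed_eq (by fun_prop) (by fun_prop)
    | ih r =>
      induction y using tensor_induction with
      | hp => exact isClosed_eq (by fun_prop) (by fun_prop)
      | ih s =>
        induction z using tensor_induction with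
        | hp => exact isClosed_eq (by fun_prop) (by fun_prop)
        | ih t => simp [mulT_assoc]
  norm_mul_le x y := by
    change ‖mulC A B x y‖ ≤ ‖x‖ * ‖y‖
    induction x using tensor_induction with
    | hp => exact isClosed_le (by fun_prop) (by fun_prop)
    | ih r =>
      induction y using tensor_induction with
      | hp => exact isClosed_le (by fun_prop) (by fun_prop)
      | ih s => simpa [norm_toTensor] using spatialNorm_mulT_le r s

theorem mul_eq_mulC (x y : CStarTensor A B) : x * y = mulC A B x y := rfl

instance : StarRing (CStarTensor A B) where
  star x := starC A B x
  star_involutive x := by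
    change starC A B (starC A B x) = x
    induction x using tensor_induction with
    | hp => exact isClosed_eq (by fun_prop) (by fun_prop)
    | ih r => simp [starT_starT]
  star_mul x y := by
    change starC A B (mulC A B x y) = mulC A B (starC A B y) (starC A B x)
    induction x using tensor_induction with
    | hp => exact isClosed_eq (by fun_prop) (by fun_prop)
    | ih r =>
      induction y using tensor_induction with
      | hp => exact isClosed_eq (by fun_prop) (by fun_prop)
      | ih s => simp [starT_mulT]
  star_add x y := map_add (starC A B) x y

theorem star_eq_starC (x : CStarTensor A B) : star x = starC A B x := rfl

instance : NonUnitalCStarAlgebra (CStarTensor A B) where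
  smul_assoc c x y := by
    change mulC A B (c • x) y = c • mulC A B x y
    rw [map_smul, smul_apply]
  smul_comm c x y := (map_smul (mulC A B x) c y).symm
  star_smul c x := (starC A B).map_smulₛₗ c x
  norm_mul_self_le x := by
    change ‖x‖ * ‖x‖ ≤ ‖mulC A B (starC A B x) x‖
    induction x using tensor_induction with
    | hp => exact isClosed_le (by fun_prop) (by fun_prop)
    | ih r => simpa [norm_toTensor] using spatialNorm_sq_le r

end CStarTensor

/-! ### Inner products of Hilbert modules -/

section HilbertModule

theorem exists_negPart {A : Type*} [NonUnitalCStarAlgebra A] {G : A} (hG : IsSelfAdjoint G) :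
    ∃ E N : A, star N = N ∧ N = star E * E ∧ N * G * N = -(star (E * N) * (E * N)) ∧ (N = 0 → ∃ C, G = star C * C) := by
  let _ : PartialOrder A := CStarAlgebra.spectralOrder A
  have _ : StarOrderedRing A := CStarAlgebra.spectralOrderedRing A
  have hN0 : 0 ≤ G⁻ := CFC.negPart_nonneg G
  have hPN : G⁺ - G⁻ = G := CFC.posPart_sub_negPart G hG
  obtain ⟨E, hE⟩ := CStarAlgebra.nonneg_iff_eq_star_mul_self.1 hN0
  have hNs : star (G⁻) = G⁻ := (IsSelfAdjoint.of_nonneg hN0).star_eq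
  refine ⟨E, G⁻, hNs, hE, ?_, fun h => ?_⟩
  · calc G⁻ * G * G⁻ = G⁻ * (G⁺ - G⁻) * G⁻ := by rw [hPN]
      _ = -(G⁻ * G⁻ * G⁻) := by
        rw [mul_sub, CFC.negPart_mul_posPart, zero_sub, neg_mul]
      _ = -(G⁻ * (star E * E) * G⁻) := by rw [← hE]
      _ = _ := by rw [star_mul, hNs]; simp only [mul_assoc]
  · rw [← hPN, h, sub_zero]
    exact CStarAlgebra.nonneg_iff_eq_star_mul_self.1 (CFC.posPart_nonneg G)

variable {A X : Type*} [NonUnitalCStarAlgebra A] [NormedAddCommGroup X] [NormedSpace ℂ X]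
  [CompleteSpace X] [HilbertModule A X]

open HilbertModule

theorem act_ip (a : A) (x y : X) : (ip (act a x) y : A) = star a * ip x y := by
  rw [← star_ip, ip_act, star_mul, star_ip]

/-- The Gram matrix of finitely many elements of a Hilbert module is of the form `c⋆ c`. -/
theorem exists_gram {n : ℕ} (x : Fin n → X) :
    ∃ c : Fin n → Fin n → A, ∀ i j, (ip (x i) (x j) : A) = ∑ k, star (c k i) * c k j := by
  let _ : PartialOrder A := CStarAlgebra.spectralOrder A
  have _ : StarOrderedRing A := CStarAlgebra.spectralOrderedRing A
  let G : CStarMatrix (Fin n) (Fin n) A := CStarMatrix.ofMatrix fun i j => ip (x i) (x j)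
  have hG : IsSelfAdjoint G := by
    ext i j
    exact star_ip _ _
  have mul_app : ∀ (M M' : CStarMatrix (Fin n) (Fin n) A) i j,
      (M * M') i j = ∑ k, M i k * M' k j := fun M M' i j => rfl
  have star_app : ∀ (M : CStarMatrix (Fin n) (Fin n) A) i j, (star M) i j = star (M j i) :=
    fun M i j => rfl
  obtain ⟨E, N, hNs, hE, hNGN, hC⟩ := exists_negPart hG
  suffices h : N = 0 by
    obtain ⟨C, hC⟩ := hC h
    refine ⟨C, fun i j => ?_⟩
    exact congrFun (congrFun hC i) j
  have h2 : E * N = 0 := by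
    ext l k
    revert l
    have hk : (N * G * N) k k = ip (∑ i, act (N i k) (x i)) (∑ j, act (N j k) (x j)) := by
      have hNs' : ∀ i, N k i = star (N i k) := fun i => by
        conv_lhs => rw [← hNs]
        rfl
      simp only [mul_app, map_sum, LinearMap.sum_apply, act_ip, ip_act,
        Finset.sum_mul, hNs']
      refine Finset.sum_congr rfl fun i _ => Finset.sum_congr rfl fun j _ => rfl
    have hk' : (N * G * N) k k = -∑ l, star ((E * N) l k) * (E * N) l k := by
      rw [hNGN]; rfl
    obtain ⟨b, hb⟩ := ip_self (A := A) (∑ i, act (N i k) (x i))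
    have h3 : (0 : A) ≤ ∑ l, star ((E * N) l k) * (E * N) l k :=
      Finset.sum_nonneg fun l _ => star_mul_self_nonneg _
    have h4 : ∑ l, star ((E * N) l k) * (E * N) l k = 0 := by
      refine le_antisymm ?_ h3
      rw [← neg_nonneg, ← hk', hk, hb]
      exact star_mul_self_nonneg b
    intro l
    have := (Finset.sum_eq_zero_iff_of_nonneg
      (fun l _ => star_mul_self_nonneg ((E * N) l k))).1 h4 l (Finset.mem_univ l)
    exact CStarRing.star_mul_self_eq_zero_iff _ |>.1 this
  have h6 : N * N = 0 := by
    conv_lhs => lhs; rw [hE]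
    rw [mul_assoc, h2, mul_zero]
  rw [← CStarRing.star_mul_self_eq_zero_iff, hNs, h6]

end HilbertModule

/-! ### Automatic boundedness -/

section Bounded

variable {A V : Type*} [NonUnitalCStarAlgebra A] [SeminormedAddCommGroup V]
  [InnerProductSpace ℂ V]

theorem exists_quasi_sqrt (a : A) : ∃ r : A, IsSelfAdjoint r ∧
    (2 * ‖a‖) • r + r * r = -(star a * a) := by
  have hp : IsSelfAdjoint (star a * a) := .star_mul_self a
  let f : ℝ → ℝ := fun t => √(‖a‖ ^ 2 - t) - ‖a‖
  have hf : Continuous f := by fun_prop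
  have hf0 : f 0 = 0 := by simp [f]
  refine ⟨cfcₙ f (star a * a), cfcₙ_predicate _ _, ?_⟩
  rw [← cfcₙ_smul .., ← cfcₙ_mul .., ← cfcₙ_add .., ]
  conv_rhs => rw [← cfcₙ_id ℝ (star a * a), ← cfcₙ_neg ..]
  refine cfcₙ_congr fun t ht => ?_
  have h1 : t ≤ ‖a‖ ^ 2 := by
    have := NonUnitalIsometricContinuousFunctionalCalculus.norm_quasispectrum_le
      (star a * a) ht hp
    rw [CStarRing.norm_star_mul_self, ← sq] at this
    exact (le_abs_self t).trans this
  have h2 := Real.sq_sqrt (sub_nonneg.2 h1)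
  simp only [f, smul_eq_mul, id]
  nlinarith

theorem norm_apply_le_of_adjoint (φ : A →ₗ[ℂ] V →ₗ[ℂ] V) (hmul : ∀ a b x, φ (a * b) x = φ a (φ b x))
    (hadj : ∀ a x y, ⟪φ a x, y⟫_ℂ = ⟪x, φ (star a) y⟫_ℂ) (a : A) (x : V) :
    ‖φ a x‖ ≤ ‖a‖ * ‖x‖ := by
  obtain ⟨r, hr, h⟩ := exists_quasi_sqrt a
  refine le_of_sq_le_sq ?_ (by positivity)
  rw [mul_pow]
  have h1 := norm_add_sq (𝕜 := ℂ) ((‖a‖ : ℂ) • x) (φ r x)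
  have h2 : ‖φ r x‖ ^ 2 = RCLike.re ⟪x, φ (r * r) x⟫_ℂ := by
    rw [hmul, ← inner_self_eq_norm_sq (𝕜 := ℂ), hadj, hr.star_eq]
  have h3 : ‖φ a x‖ ^ 2 = RCLike.re ⟪x, φ (star a * a) x⟫_ℂ := by
    rw [hmul, ← inner_self_eq_norm_sq (𝕜 := ℂ), hadj]
  have h4 : RCLike.re ⟪x, φ (-(star a * a)) x⟫_ℂ =
      2 * ‖a‖ * RCLike.re ⟪x, φ r x⟫_ℂ + RCLike.re ⟪x, φ (r * r) x⟫_ℂ := by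
    rw [← h, map_add, LinearMap.add_apply, inner_add_right, map_add]
    congr 1
    rw [← Complex.coe_smul, map_smul, LinearMap.smul_apply, inner_smul_right]
    simp
  rw [map_neg, LinearMap.neg_apply, inner_neg_right, map_neg, ← h3, ← h2] at h4
  rw [inner_smul_left, norm_smul, mul_pow] at h1
  simp at h1 h4
  nlinarith [sq_nonneg ‖(‖a‖ : ℂ) • x + φ r x‖]

end Bounded

/-! ### Localization of a correspondence at a representation

For a Hilbert `A`-module `X` and a representation `π` of `A` on `H`, this is the Hilbert space
`X ⊗_A H`: the completion of `X ⊗ H` with respect to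
`⟨x ⊗ h, x' ⊗ h'⟩ = ⟨h, π(⟨x, x'⟩) h'⟩`. If `X` is a correspondence, then `A` acts on it
on the left. -/

section Localization

variable {A X : Type u} [NonUnitalCStarAlgebra A] [NormedAddCommGroup X] [NormedSpace ℂ X]
  [CompleteSpace X]

open HilbertModule Correspondence

variable (A X) in
/-- The left action as a bilinear map. -/
def leftAct [Correspondence A X] : A →ₗ[ℂ] X →ₗ[ℂ] X where
  toFun a := (φ a : X →L[ℂ] X).toLinearMap
  map_add' a b := by ext x; simp
  map_smul' c a := by ext x; simp

@[simp]
theorem leftAct_apply [Correspondence A X] (a : A) (x : X) : leftAct A X a x = φ a x := rfl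

section

variable [HilbertModule A X] (π : HilbertRep A)

/-- The form `(h, h') ↦ (a ↦ ⟨h, π(a) h'⟩)`. -/
def coeffForm : π.H →ₗ⋆[ℂ] π.H →ₗ[ℂ] Module.Dual ℂ A :=
  LinearMap.mk₂'ₛₗ _ _ (fun h h' =>
    { toFun := fun a => ⟪h, π.rep a h'⟫_ℂ
      map_add' := fun a b => by simp 
      map_smul' := fun c a => by simp  })
    (fun h₁ h₂ h' => by ext a; simp )
    (fun c h h' => by ext a; simp [mul_comm])
    (fun h h₁ h₂ => by ext a; simp )
    (fun c h h' => by ext a; simp )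

variable (X) in
/-- The form `⟨x ⊗ h, x' ⊗ h'⟩ = ⟨h, π(⟨x, x'⟩) h'⟩` on `X ⊗ H`. -/
def locForm : X ⊗[ℂ] π.H →ₗ⋆[ℂ] X ⊗[ℂ] π.H →ₗ[ℂ] ℂ :=
  (TensorProduct.map₂ (ip : X →ₗ⋆[ℂ] X →ₗ[ℂ] A) (coeffForm π)).compr₂ₛₗ (contractRight ℂ A)

@[simp]
theorem locForm_tmul (x x' : X) (h h' : π.H) :
    locForm X π (x ⊗ₜ h) (x' ⊗ₜ h') = ⟪h, π.rep (ip x x') h'⟫_ℂ := rfl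

theorem locForm_symm (z w : X ⊗[ℂ] π.H) : conj (locForm X π w z) = locForm X π z w := by
  induction z using TensorProduct.induction_on with
  | zero => simp
  | add z z' h h' => simp [h, h']
  | tmul x h =>
    induction w using TensorProduct.induction_on with
    | zero => simp
    | add w w' h h' => simp only [map_add, LinearMap.add_apply, h, h']
    | tmul x' h' =>
      rw [locForm_tmul, locForm_tmul, inner_conj_symm, ← star_ip x x', ← HilbertRep.inner_rep,
        star_star]

theorem locForm_nonneg (z : X ⊗[ℂ] π.H) : 0 ≤ RCLike.re (locForm X π z z) := by
  obtain ⟨n, x, h, rfl⟩ := TensorProduct.exists_sum_tmul_eq z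
  obtain ⟨c, hc⟩ := exists_gram (A := A) x
  have : locForm X π (∑ i, x i ⊗ₜ h i) (∑ i, x i ⊗ₜ h i)
      = ∑ k, ⟪∑ i, π.rep (c k i) (h i), ∑ i, π.rep (c k i) (h i)⟫_ℂ := by
    simp only [map_sum, LinearMap.sum_apply, locForm_tmul, hc, inner_sum, sum_inner,
      sum_apply, map_mul]
    rw [Finset.sum_congr rfl fun i _ => Finset.sum_comm, Finset.sum_comm]
    refine Finset.sum_congr rfl fun k _ => ?_
    refine Finset.sum_congr rfl fun i _ => Finset.sum_congr rfl fun j _ => ?_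
    rw [mul_apply_eq_comp, HilbertRep.inner_rep]
  rw [this, map_sum]
  exact Finset.sum_nonneg fun k _ => inner_self_nonneg

variable (X) in
/-- The space `X ⊗ H` with the semi-inner product `locForm`. -/
@[nolint unusedArguments]
def PreLoc (π : HilbertRep A) : Type u := X ⊗[ℂ] π.H

instance : AddCommGroup (PreLoc X π) := inferInstanceAs (AddCommGroup (X ⊗[ℂ] π.H))
instance : Module ℂ (PreLoc X π) := inferInstanceAs (Module ℂ (X ⊗[ℂ] π.H))

variable (X) in
/-- The semi-inner product of `PreLoc`. -/
abbrev preLocCore : PreInnerProductSpace.Core ℂ (PreLoc X π) where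
  inner z w := locForm X π z w
  conj_inner_symm z w := locForm_symm π z w
  re_inner_nonneg z := locForm_nonneg π z
  add_left z z' w := LinearMap.congr_fun (map_add (locForm X π) z z') w
  smul_left z w c := LinearMap.congr_fun ((locForm X π).map_smulₛₗ c z) w

instance : SeminormedAddCommGroup (PreLoc X π) :=
  InnerProductSpace.Core.toSeminormedAddCommGroup (c := preLocCore X π)

instance : InnerProductSpace ℂ (PreLoc X π) := InnerProductSpace.ofCore (preLocCore X π)

theorem preLoc_inner (z w : PreLoc X π) : ⟪z, w⟫_ℂ = locForm X π z w := rfl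

end

section

variable [Correspondence A X] (π : HilbertRep A)

variable (X) in
/-- The left action of `A` on `X ⊗ H`. -/
def locAct : A →ₗ[ℂ] X ⊗[ℂ] π.H →ₗ[ℂ] X ⊗[ℂ] π.H where
  toFun a := TensorProduct.map (leftAct A X a) LinearMap.id
  map_add' a b := by rw [map_add, TensorProduct.map_add_left]
  map_smul' c a := by rw [map_smul, TensorProduct.map_smul_left]; rfl

theorem locAct_tmul (a : A) (x : X) (h : π.H) :
    locAct X π a (x ⊗ₜ h) = (φ a x : X) ⊗ₜ h := rfl

theorem locAct_mul (a b : A) (z : X ⊗[ℂ] π.H) :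
    locAct X π (a * b) z = locAct X π a (locAct X π b z) := by
  induction z using TensorProduct.induction_on with
  | zero => simp
  | add z w h h' => rw [map_add, map_add, map_add, h, h']
  | tmul x h => rw [locAct_tmul, locAct_tmul, locAct_tmul, map_mul, mul_apply_eq_comp]

theorem locForm_locAct (a : A) (z w : X ⊗[ℂ] π.H) :
    locForm X π (locAct X π a z) w = locForm X π z (locAct X π (star a) w) := by
  induction z using TensorProduct.induction_on with
  | zero => simp
  | add z z' h h' => simp only [map_add, LinearMap.add_apply, h, h']
  | tmul x h =>
    induction w using TensorProduct.induction_on with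
    | zero => simp
    | add w w' h h' => simp only [map_add, h, h']
    | tmul x' h' => rw [locAct_tmul, locAct_tmul, locForm_tmul, locForm_tmul, ip_φ]

variable (X) in
/-- The left action of `A` on `X ⊗ H` by bounded operators. -/
def preLocActL (a : A) : PreLoc X π →L[ℂ] PreLoc X π :=
  LinearMap.mkContinuous (E := PreLoc X π) (F := PreLoc X π) (locAct X π a) ‖a‖ fun z =>
    norm_apply_le_of_adjoint (V := PreLoc X π) (locAct X π) (locAct_mul π) (locForm_locAct π) a z

theorem preLocActL_apply (a : A) (z : PreLoc X π) : preLocActL X π a z = locAct X π a z := rfl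

theorem preLocActL_add (a b : A) : preLocActL X π (a + b) = preLocActL X π a + preLocActL X π b :=
  ContinuousLinearMap.ext fun z => LinearMap.congr_fun (map_add (locAct X π) a b) z

theorem preLocActL_smul (c : ℂ) (a : A) : preLocActL X π (c • a) = c • preLocActL X π a :=
  ContinuousLinearMap.ext fun z => LinearMap.congr_fun (map_smul (locAct X π) c a) z

theorem preLocActL_zero : preLocActL X π 0 = 0 :=
  ContinuousLinearMap.ext fun z => LinearMap.congr_fun (map_zero (locAct X π)) z

theorem preLocActL_mul (a b : A) : preLocActL X π (a * b) = preLocActL X π a ∘L preLocActL X π b :=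
  ContinuousLinearMap.ext fun z => locAct_mul π a b z

theorem preLocActL_adj (a : A) (z w : PreLoc X π) :
    ⟪preLocActL X π (star a) z, w⟫_ℂ = ⟪z, preLocActL X π a w⟫_ℂ := by
  have := locForm_locAct π (star a) z w
  rw [star_star] at this
  exact this

variable (X) in
/-- The representation of `A` on the Hilbert space `X ⊗_A H`. -/
def HilbertRep.loc : HilbertRep A where
  H := Completion (PreLoc X π)
  rep :=
    { toFun := fun a => (preLocActL X π a).completion
      map_smul' := fun c a => DFunLike.coe_injective <| Completion.ext
        (ContinuousLinearMap.continuous _) (ContinuousLinearMap.continuous _) fun z => by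
          rw [smul_apply, ContinuousLinearMap.completion_apply_coe,
            ContinuousLinearMap.completion_apply_coe, ← Completion.coe_smul]
          rw [preLocActL_smul]; rfl
      map_zero' := DFunLike.coe_injective <| Completion.ext
        (ContinuousLinearMap.continuous _) (ContinuousLinearMap.continuous _) fun z => by
          rw [zero_apply, ContinuousLinearMap.completion_apply_coe, ← Completion.coe_zero]
          rw [preLocActL_zero]; rfl
      map_add' := fun a b => DFunLike.coe_injective <| Completion.ext
        (ContinuousLinearMap.continuous _) (ContinuousLinearMap.continuous _) fun z => by
          rw [add_apply, ContinuousLinearMap.completion_apply_coe,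
            ContinuousLinearMap.completion_apply_coe, ContinuousLinearMap.completion_apply_coe,
            ← Completion.coe_add]
          rw [preLocActL_add]; rfl
      map_mul' := fun a b => DFunLike.coe_injective <| Completion.ext
        (ContinuousLinearMap.continuous _) (ContinuousLinearMap.continuous _) fun z => by
          rw [mul_apply_eq_comp, ContinuousLinearMap.completion_apply_coe,
            ContinuousLinearMap.completion_apply_coe, ContinuousLinearMap.completion_apply_coe]
          rw [preLocActL_mul]; rfl
      map_star' := fun a => by
        refine (ContinuousLinearMap.eq_adjoint_iff _ _).2 fun z w => ?_
        induction z, w using Completion.induction_on₂ with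
        | hp => exact isClosed_eq (by fun_prop) (by fun_prop)
        | ih z w =>
          rw [ContinuousLinearMap.completion_apply_coe, ContinuousLinearMap.completion_apply_coe,
            Completion.inner_coe, Completion.inner_coe]
          exact preLocActL_adj π a z w }

variable (X) in
/-- The bilinear map `(x, h) ↦ x ⊗ h` into `X ⊗ H`. -/
def preLocMk : X →ₗ[ℂ] π.H →ₗ[ℂ] PreLoc X π := TensorProduct.mk ℂ X π.H

theorem preLocMk_inner (x x' : X) (h h' : π.H) :
    ⟪preLocMk X π x h, preLocMk X π x' h'⟫_ℂ = ⟪h, π.rep (ip x x') h'⟫_ℂ := rfl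

theorem norm_preLocMk_le (x : X) (h : π.H) : ‖preLocMk X π x h‖ ≤ ‖x‖ * ‖h‖ := by
  refine le_of_sq_le_sq ?_ (by positivity)
  rw [← inner_self_eq_norm_sq (𝕜 := ℂ), mul_pow, norm_sq (A := A) x, preLocMk_inner]
  refine (Complex.re_le_norm _).trans ((norm_inner_le_norm _ _).trans ?_)
  have h1 := ((π.rep (ip x x)).le_opNorm h).trans
    (mul_le_mul_of_nonneg_right (π.norm_rep_le (ip x x)) (norm_nonneg h))
  nlinarith [norm_nonneg h]

variable (X) in
/-- The operators `H → X ⊗_A H`, `h ↦ x ⊗ h`. -/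
def creation : X →ₗ[ℂ] π.H →L[ℂ] (π.loc X).H where
  toFun x := Completion.toComplL (𝕜 := ℂ) (E := PreLoc X π) ∘L
    (preLocMk X π x).mkContinuous ‖x‖ (norm_preLocMk_le π x)
  map_add' x y := ContinuousLinearMap.ext fun h => by
    rw [add_apply]
    exact (congrArg _ (LinearMap.congr_fun (map_add (preLocMk X π) x y) h)).trans
      (Completion.coe_add (α := PreLoc X π) _ _)
  map_smul' c x := ContinuousLinearMap.ext fun h => by
    rw [smul_apply]
    exact (congrArg ((↑) : PreLoc X π → Completion (PreLoc X π))
      (LinearMap.congr_fun (map_smul (preLocMk X π) c x) h)).trans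
      (Completion.coe_smul c (preLocMk X π x h))

theorem inner_creation (x x' : X) (h h' : π.H) :
    ⟪creation X π x h, creation X π x' h'⟫_ℂ = ⟪h, π.rep (ip x x') h'⟫_ℂ :=
  Completion.inner_coe (E := PreLoc X π) _ _

theorem creation_φ (a : A) (x : X) (h : π.H) :
    creation X π (φ a x) h = (π.loc X).rep a (creation X π x h) :=
  (ContinuousLinearMap.completion_apply_coe (preLocActL X π a) (preLocMk X π x h)).symm

end

end Localization

/-! ### The external tensor product of correspondences -/

section External

open HilbertModule Correspondence

section Algebraic

variable {A X : Type u} {B Y : Type v} [NonUnitalCStarAlgebra A] [NonUnitalCStarAlgebra B]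
  [NormedAddCommGroup X] [NormedSpace ℂ X] [CompleteSpace X]
  [NormedAddCommGroup Y] [NormedSpace ℂ Y] [CompleteSpace Y]

section

variable [HilbertModule A X] [HilbertModule B Y]

variable (A B X Y) in
/-- The inner product `⟨x ⊗ y, x' ⊗ y'⟩ = ⟨x, x'⟩ ⊗ ⟨y, y'⟩`. -/
def ipT : X ⊗[ℂ] Y →ₗ⋆[ℂ] X ⊗[ℂ] Y →ₗ[ℂ] A ⊗[ℂ] B :=
  TensorProduct.map₂ (ip : X →ₗ⋆[ℂ] X →ₗ[ℂ] A) (ip : Y →ₗ⋆[ℂ] Y →ₗ[ℂ] B)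

variable (A B X Y) in
/-- The right action `(x ⊗ y) · (a ⊗ b) = (x · a) ⊗ (y · b)`. -/
def actT : A ⊗[ℂ] B →ₗ[ℂ] X ⊗[ℂ] Y →ₗ[ℂ] X ⊗[ℂ] Y :=
  TensorProduct.map₂ (act : A →ₗ[ℂ] X →ₗ[ℂ] X) (act : B →ₗ[ℂ] Y →ₗ[ℂ] Y)

@[simp]
theorem ipT_tmul (x x' : X) (y y' : Y) :
    ipT A X B Y (x ⊗ₜ y) (x' ⊗ₜ y') = ip x x' ⊗ₜ ip y y' := rfl

@[simp]
theorem actT_tmul (a : A) (b : B) (x : X) (y : Y) :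
    actT A X B Y (a ⊗ₜ b) (x ⊗ₜ y) = act a x ⊗ₜ act b y := rfl

theorem actT_mulT (s t : A ⊗[ℂ] B) (z : X ⊗[ℂ] Y) :
    actT A X B Y (mulT A B s t) z = actT A X B Y t (actT A X B Y s z) := by
  induction z using TensorProduct.induction_on with
  | zero => simp
  | add z z' h h' => simp only [map_add, h, h']
  | tmul x y =>
    induction s using TensorProduct.induction_on with
    | zero => simp
    | add s s' h h' => simp only [map_add, LinearMap.add_apply, h, h']
    | tmul a b =>
      induction t using TensorProduct.induction_on with
      | zero => simp
      | add t t' h h' => simp only [map_add, LinearMap.add_apply, h, h']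
      | tmul a' b' => simp [act_mul]

theorem ipT_actT (z w : X ⊗[ℂ] Y) (t : A ⊗[ℂ] B) :
    ipT A X B Y z (actT A X B Y t w) = mulT A B (ipT A X B Y z w) t := by
  induction z using TensorProduct.induction_on with
  | zero => simp
  | add z z' h h' => simp only [map_add, LinearMap.add_apply, h, h']
  | tmul x y =>
    induction w using TensorProduct.induction_on with
    | zero => simp
    | add w w' h h' => simp only [map_add, LinearMap.add_apply, h, h']
    | tmul x' y' =>
      induction t using TensorProduct.induction_on with
      | zero => simp
      | add t t' h h' => simp only [map_add, LinearMap.add_apply, h, h']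
      | tmul a b => simp [ip_act]

theorem starT_ipT (z w : X ⊗[ℂ] Y) : starT A B (ipT A X B Y z w) = ipT A X B Y w z := by
  induction z using TensorProduct.induction_on with
  | zero => simp
  | add z z' h h' => simp only [map_add, LinearMap.add_apply, h, h']
  | tmul x y =>
    induction w using TensorProduct.induction_on with
    | zero => simp
    | add w w' h h' => simp only [map_add, LinearMap.add_apply, h, h']
    | tmul x' y' => simp [star_ip]

/-- The inner product of `z` with itself is a sum of elements of the form `s⋆ s`. -/
theorem exists_ipT_self (z : X ⊗[ℂ] Y) : ∃ (n : ℕ) (s : Fin n → Fin n → A ⊗[ℂ] B),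
    ipT A X B Y z z = ∑ k, ∑ l, mulT A B (starT A B (s k l)) (s k l) := by
  obtain ⟨n, x, y, rfl⟩ := TensorProduct.exists_sum_tmul_eq z
  obtain ⟨c, hc⟩ := exists_gram (A := A) x
  obtain ⟨d, hd⟩ := exists_gram (A := B) y
  refine ⟨n, fun k l => ∑ i, c k i ⊗ₜ d l i, ?_⟩
  simp only [map_sum, LinearMap.sum_apply, ipT_tmul, hc, hd, TensorProduct.sum_tmul,
    TensorProduct.tmul_sum, starT_tmul, mulT_tmul]
  rw [Finset.sum_congr rfl fun i _ => Finset.sum_congr rfl fun j _ => Finset.sum_comm]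
  rw [Finset.sum_congr rfl fun i _ => Finset.sum_comm, Finset.sum_comm]
  refine Finset.sum_congr rfl fun k _ => ?_
  rw [Finset.sum_congr rfl fun i _ => Finset.sum_comm, Finset.sum_comm]

end

variable [Correspondence A X] [Correspondence B Y]

variable (A B X Y) in
/-- The left action `(a ⊗ b) · (x ⊗ y) = (a · x) ⊗ (b · y)`. -/
def leftT : A ⊗[ℂ] B →ₗ[ℂ] X ⊗[ℂ] Y →ₗ[ℂ] X ⊗[ℂ] Y :=
  TensorProduct.map₂ (leftAct A X) (leftAct B Y)

@[simp]
theorem leftT_tmul (a : A) (b : B) (x : X) (y : Y) :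
    leftT A X B Y (a ⊗ₜ b) (x ⊗ₜ y) = (φ a x : X) ⊗ₜ (φ b y : Y) := rfl

theorem leftT_mulT (s t : A ⊗[ℂ] B) (z : X ⊗[ℂ] Y) :
    leftT A X B Y (mulT A B s t) z = leftT A X B Y s (leftT A X B Y t z) := by
  induction z using TensorProduct.induction_on with
  | zero => simp
  | add z z' h h' => simp only [map_add, h, h']
  | tmul x y =>
    induction s using TensorProduct.induction_on with
    | zero => simp
    | add s s' h h' => simp only [map_add, LinearMap.add_apply, h, h']
    | tmul a b =>
      induction t using TensorProduct.induction_on with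
      | zero => simp
      | add t t' h h' => simp only [map_add, LinearMap.add_apply, h, h']
      | tmul a' b' => simp [map_mul]

theorem ipT_leftT (z w : X ⊗[ℂ] Y) (t : A ⊗[ℂ] B) :
    ipT A X B Y (leftT A X B Y t z) w = ipT A X B Y z (leftT A X B Y (starT A B t) w) := by
  induction z using TensorProduct.induction_on with
  | zero => simp
  | add z z' h h' => simp only [map_add, LinearMap.add_apply, h, h']
  | tmul x y =>
    induction w using TensorProduct.induction_on with
    | zero => simp
    | add w w' h h' => simp only [map_add, h, h']
    | tmul x' y' =>
      induction t using TensorProduct.induction_on with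
      | zero => simp
      | add t t' h h' => simp only [map_add, LinearMap.add_apply, h, h']
      | tmul a b => simp [ip_φ]

section

variable (π : HilbertRep A) (ρ : HilbertRep B)

variable (X Y) in
/-- The operators `H ⊗ K → (X ⊗_A H) ⊗ (Y ⊗_B K)`, `h ⊗ k ↦ (x ⊗ h) ⊗ (y ⊗ k)`. -/
def creationT : X ⊗[ℂ] Y →ₗ[ℂ] (π.H ⊗[ℂ] ρ.H →L[ℂ] (π.loc X).H ⊗[ℂ] (ρ.loc Y).H) :=
  TensorProduct.lift <| LinearMap.mk₂ ℂ
    (fun x y => TensorProduct.mapL (creation X π x) (creation Y ρ y))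
    (fun a a' b => by rw [map_add, TensorProduct.mapL_add_left])
    (fun c a b => by rw [map_smul, TensorProduct.mapL_smul_left])
    (fun a b b' => by rw [map_add, TensorProduct.mapL_add_right])
    (fun c a b => by rw [map_smul, TensorProduct.mapL_smul_right])

theorem creationT_tmul (x : X) (y : Y) (h : π.H) (k : ρ.H) :
    creationT X Y π ρ (x ⊗ₜ y) (h ⊗ₜ k) = creation X π x h ⊗ₜ creation Y ρ y k := rfl

theorem inner_creationT (z w : X ⊗[ℂ] Y) (ξ η : π.H ⊗[ℂ] ρ.H) :
    ⟪creationT X Y π ρ z ξ, creationT X Y π ρ w η⟫_ℂ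
      = ⟪ξ, π.tensor ρ (ipT A X B Y z w) η⟫_ℂ := by
  induction z using TensorProduct.induction_on with
  | zero => simp
  | add z z' h h' =>
    simp only [map_add, LinearMap.add_apply, add_apply, inner_add_left, inner_add_right, h, h']
  | tmul x y =>
    induction w using TensorProduct.induction_on with
    | zero => simp
    | add w w' h h' => simp only [map_add, add_apply, inner_add_right, h, h']
    | tmul x' y' =>
      induction ξ using TensorProduct.induction_on with
      | zero => simp
      | add ξ ξ' h h' => simp only [map_add, inner_add_left, h, h']
      | tmul h k =>
        induction η using TensorProduct.induction_on with
        | zero => simp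
        | add η η' h h' => simp only [map_add, inner_add_right, h, h']
        | tmul h' k' =>
          rw [creationT_tmul, creationT_tmul, TensorProduct.inner_tmul, inner_creation,
            inner_creation, ipT_tmul, HilbertRep.tensor_tmul, TensorProduct.mapL_tmul,
            TensorProduct.inner_tmul]

theorem creationT_leftT (t : A ⊗[ℂ] B) (z : X ⊗[ℂ] Y) :
    creationT X Y π ρ (leftT A X B Y t z)
      = (π.loc X).tensor (ρ.loc Y) t ∘L creationT X Y π ρ z := by
  ext ξ
  induction t using TensorProduct.induction_on with
  | zero => simp
  | add t t' h h' =>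
    simp only [map_add, LinearMap.add_apply, add_apply, ContinuousLinearMap.comp_apply] at h h' ⊢
    rw [h, h']
  | tmul a b =>
    induction z using TensorProduct.induction_on with
    | zero => simp
    | add z z' h h' =>
      simp only [map_add, add_apply, ContinuousLinearMap.comp_apply] at h h' ⊢
      rw [h, h']
    | tmul x y =>
      induction ξ using TensorProduct.induction_on with
      | zero => simp
      | add ξ ξ' h h' => simp only [map_add, h, h']
      | tmul h k =>
        rw [leftT_tmul, creationT_tmul, ContinuousLinearMap.comp_apply, creationT_tmul,
          HilbertRep.tensor_tmul, TensorProduct.mapL_tmul, creation_φ, creation_φ]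

end

variable (A B) in
/-- The norm `‖⟨z, z⟩‖ ^ (1 / 2)` of the algebraic tensor product of two correspondences. -/
def extNorm (z : X ⊗[ℂ] Y) : ℝ := √(spatialNorm (ipT A X B Y z z))

theorem extNorm_nonneg (z : X ⊗[ℂ] Y) : 0 ≤ extNorm A B z := Real.sqrt_nonneg _

theorem extNorm_sq (z : X ⊗[ℂ] Y) : extNorm A B z ^ 2 = spatialNorm (ipT A X B Y z z) :=
  Real.sq_sqrt (spatialNorm_nonneg _)

theorem norm_creationT_le (π : HilbertRep A) (ρ : HilbertRep B) (z : X ⊗[ℂ] Y) :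
    ‖creationT X Y π ρ z‖ ≤ extNorm A B z := by
  refine ContinuousLinearMap.opNorm_le_bound _ (extNorm_nonneg z) fun ξ => ?_
  refine le_of_sq_le_sq ?_ (mul_nonneg (extNorm_nonneg z) (norm_nonneg ξ))
  rw [mul_pow, extNorm_sq, ← inner_self_eq_norm_sq (𝕜 := ℂ), inner_creationT]
  refine (Complex.re_le_norm _).trans ((norm_inner_le_norm ξ
    (π.tensor ρ (ipT A X B Y z z) ξ)).trans ?_)
  have := ((π.tensor ρ (ipT A X B Y z z)).le_opNorm ξ).trans
    (mul_le_mul_of_nonneg_right (norm_tensor_le π ρ _) (norm_nonneg ξ))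
  nlinarith [norm_nonneg ξ]

theorem norm_tensor_ipT_le (π : HilbertRep A) (ρ : HilbertRep B) (z w : X ⊗[ℂ] Y) :
    ‖π.tensor ρ (ipT A X B Y z w)‖ ≤ ‖creationT X Y π ρ z‖ * ‖creationT X Y π ρ w‖ := by
  have h0 := ContinuousLinearMap.opNorm_nonneg (creationT X Y π ρ z)
  have h1 := ContinuousLinearMap.opNorm_nonneg (creationT X Y π ρ w)
  refine ContinuousLinearMap.opNorm_le_bound _ (mul_nonneg h0 h1) fun η => ?_
  set ζ := π.tensor ρ (ipT A X B Y z w) η with hζ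
  have h2 : ‖ζ‖ ^ 2 ≤ (‖creationT X Y π ρ z‖ * ‖ζ‖) * (‖creationT X Y π ρ w‖ * ‖η‖) := by
    rw [← inner_self_eq_norm_sq (𝕜 := ℂ)]
    nth_rw 2 [hζ]
    rw [← inner_creationT]
    refine (Complex.re_le_norm _).trans ((norm_inner_le_norm (𝕜 := ℂ)
      (creationT X Y π ρ z ζ) (creationT X Y π ρ w η)).trans ?_)
    exact mul_le_mul ((creationT X Y π ρ z).le_opNorm ζ) ((creationT X Y π ρ w).le_opNorm η)
      (norm_nonneg _) (mul_nonneg h0 (norm_nonneg _))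
  rcases (norm_nonneg ζ).eq_or_lt with h | h
  · rw [← h]; exact mul_nonneg (mul_nonneg h0 h1) (norm_nonneg _)
  · refine le_of_mul_le_mul_left ?_ h
    nlinarith

theorem extNorm_le {z : X ⊗[ℂ] Y} {C : ℝ} (hC : 0 ≤ C)
    (h : ∀ (π : HilbertRep A) (ρ : HilbertRep B), ‖creationT X Y π ρ z‖ ≤ C) :
    extNorm A B z ≤ C := by
  refine Real.sqrt_le_iff.2 ⟨hC, spatialNorm_le fun π ρ => ?_⟩
  refine (norm_tensor_ipT_le π ρ z z).trans ?_
  rw [sq]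
  exact mul_le_mul (h π ρ) (h π ρ) (ContinuousLinearMap.opNorm_nonneg _) hC

theorem spatialNorm_ipT_le (z w : X ⊗[ℂ] Y) :
    spatialNorm (ipT A X B Y z w) ≤ extNorm A B z * extNorm A B w :=
  spatialNorm_le fun π ρ => (norm_tensor_ipT_le π ρ z w).trans <|
    mul_le_mul (norm_creationT_le π ρ z) (norm_creationT_le π ρ w)
      (ContinuousLinearMap.opNorm_nonneg _) (extNorm_nonneg z)

theorem extNorm_leftT_le (t : A ⊗[ℂ] B) (z : X ⊗[ℂ] Y) :
    extNorm A B (leftT A X B Y t z) ≤ spatialNorm t * extNorm A B z := by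
  refine extNorm_le (mul_nonneg (spatialNorm_nonneg t) (extNorm_nonneg z)) fun π ρ => ?_
  rw [creationT_leftT]
  refine (ContinuousLinearMap.opNorm_comp_le _ _).trans ?_
  exact mul_le_mul (norm_tensor_le _ _ t) (norm_creationT_le π ρ z) (norm_nonneg _)
    (spatialNorm_nonneg t)

theorem extNorm_actT_le (t : A ⊗[ℂ] B) (z : X ⊗[ℂ] Y) :
    extNorm A B (actT A X B Y t z) ≤ spatialNorm t * extNorm A B z := by
  refine Real.sqrt_le_iff.2 ⟨mul_nonneg (spatialNorm_nonneg t) (extNorm_nonneg z), ?_⟩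
  rw [mul_pow, extNorm_sq, ipT_actT, ← starT_ipT z, ipT_actT, starT_mulT, starT_ipT]
  have h1 := spatialNorm_mulT_le (mulT A B (starT A B t) (ipT A X B Y z z)) t
  have h2 := spatialNorm_mulT_le (starT A B t) (ipT A X B Y z z)
  rw [spatialNorm_starT] at h2
  nlinarith [mul_le_mul_of_nonneg_right h2 (spatialNorm_nonneg t)]

variable (A B X Y) in
/-- The norm of the algebraic tensor product of two correspondences as a seminorm. -/
def extSeminorm : Seminorm ℂ (X ⊗[ℂ] Y) :=
  Seminorm.ofSMulLE (extNorm A B)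
    (by
      refine le_antisymm (extNorm_le le_rfl fun π ρ => ?_) (extNorm_nonneg _)
      rw [map_zero]; exact ContinuousLinearMap.opNorm_zero.le)
    (fun z w => by
      refine extNorm_le (add_nonneg (extNorm_nonneg z) (extNorm_nonneg w)) fun π ρ => ?_
      rw [map_add]
      exact (norm_add_le (creationT X Y π ρ z) (creationT X Y π ρ w)).trans
        (add_le_add (norm_creationT_le π ρ z) (norm_creationT_le π ρ w)))
    (fun c z => by
      refine extNorm_le (mul_nonneg (norm_nonneg c) (extNorm_nonneg z)) fun π ρ => ?_
      rw [map_smul]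
      exact (ContinuousLinearMap.opNorm_smul_le c (creationT X Y π ρ z)).trans
        (mul_le_mul_of_nonneg_left (norm_creationT_le π ρ z) (norm_nonneg c)))

end Algebraic

section Completed

variable (A X : Type u) (B Y : Type v) [NonUnitalCStarAlgebra A] [NonUnitalCStarAlgebra B]
  [NormedAddCommGroup X] [NormedSpace ℂ X] [CompleteSpace X]
  [NormedAddCommGroup Y] [NormedSpace ℂ Y] [CompleteSpace Y]
  [Correspondence A X] [Correspondence B Y]

/-- The algebraic tensor product of two correspondences, with the norm `extNorm`. -/
@[nolint unusedArguments]
def AlgExt (A X : Type u) (B Y : Type v) [NonUnitalCStarAlgebra A] [NonUnitalCStarAlgebra B]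
    [NormedAddCommGroup X] [NormedSpace ℂ X] [CompleteSpace X]
    [NormedAddCommGroup Y] [NormedSpace ℂ Y] [CompleteSpace Y]
    [Correspondence A X] [Correspondence B Y] : Type (max u v) := X ⊗[ℂ] Y

instance : SeminormedAddCommGroup (AlgExt A X B Y) :=
  (extSeminorm A X B Y).toAddGroupSeminorm.toSeminormedAddCommGroup

instance : NormedSpace ℂ (AlgExt A X B Y) where
  __ : Module ℂ (AlgExt A X B Y) := inferInstanceAs (Module ℂ (X ⊗[ℂ] Y))
  norm_smul_le c t := (map_smul_eq_mul (extSeminorm A X B Y) c t).le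

/-- The external tensor product `X ⊗ Y` of a correspondence over `A` and one over `B`. -/
def ExtTensor : Type (max u v) := Completion (AlgExt A X B Y)

instance : NormedAddCommGroup (ExtTensor A X B Y) :=
  inferInstanceAs (NormedAddCommGroup (Completion (AlgExt A X B Y)))

instance : NormedSpace ℂ (ExtTensor A X B Y) :=
  inferInstanceAs (NormedSpace ℂ (Completion (AlgExt A X B Y)))

instance : CompleteSpace (ExtTensor A X B Y) :=
  inferInstanceAs (CompleteSpace (Completion (AlgExt A X B Y)))

/-- The canonical map of the algebraic tensor product to the external tensor product. -/
def toExt : X ⊗[ℂ] Y →ₗ[ℂ] ExtTensor A X B Y :=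
  (Completion.toComplₗᵢ (𝕜 := ℂ) (E := AlgExt A X B Y)).toLinearMap

theorem norm_toExt (z : X ⊗[ℂ] Y) : ‖toExt A X B Y z‖ = extNorm A B z :=
  Completion.norm_coe (E := AlgExt A X B Y) z

variable {A X B Y} in
theorem ext_induction {p : ExtTensor A X B Y → Prop} (z : ExtTensor A X B Y)
    (hp : IsClosed {z | p z}) (ih : ∀ t : X ⊗[ℂ] Y, p (toExt A X B Y t)) : p z :=
  Completion.induction_on (α := AlgExt A X B Y) z hp ih

/-- The inner product of the external tensor product. -/
def ipE : ExtTensor A X B Y →L⋆[ℂ] ExtTensor A X B Y →L[ℂ] CStarTensor A B :=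
  extendBilin (E := AlgExt A X B Y) (F := AlgExt A X B Y) (G := AlgTensor A B) (ipT A X B Y) 1
    fun z w => by
      change spatialNorm (ipT A X B Y z w) ≤ 1 * extNorm A B (X := X) (Y := Y) z * extNorm A B w
      rw [one_mul]
      exact spatialNorm_ipT_le z w

/-- The right action on the external tensor product. -/
def actE : CStarTensor A B →L[ℂ] ExtTensor A X B Y →L[ℂ] ExtTensor A X B Y :=
  extendBilin (E := AlgTensor A B) (F := AlgExt A X B Y) (G := AlgExt A X B Y) (actT A X B Y) 1
    fun t z => by
      change extNorm A B (actT A X B Y t z) ≤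
        1 * spatialNorm (A := A) (B := B) t * extNorm A B (X := X) (Y := Y) z
      rw [one_mul]
      exact extNorm_actT_le t z

/-- The left action on the external tensor product. -/
def leftE : CStarTensor A B →L[ℂ] ExtTensor A X B Y →L[ℂ] ExtTensor A X B Y :=
  extendBilin (E := AlgTensor A B) (F := AlgExt A X B Y) (G := AlgExt A X B Y) (leftT A X B Y) 1
    fun t z => by
      change extNorm A B (leftT A X B Y t z) ≤
        1 * spatialNorm (A := A) (B := B) t * extNorm A B (X := X) (Y := Y) z
      rw [one_mul]
      exact extNorm_leftT_le t z

@[simp]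
theorem ipE_coe (z w : X ⊗[ℂ] Y) :
    ipE A X B Y (toExt A X B Y z) (toExt A X B Y w) = toTensor A B (ipT A X B Y z w) :=
  extendBilin_coe (E := AlgExt A X B Y) (F := AlgExt A X B Y) (G := AlgTensor A B) _ _ _ z w

@[simp]
theorem actE_coe (t : A ⊗[ℂ] B) (z : X ⊗[ℂ] Y) :
    actE A X B Y (toTensor A B t) (toExt A X B Y z) = toExt A X B Y (actT A X B Y t z) :=
  extendBilin_coe (E := AlgTensor A B) (F := AlgExt A X B Y) (G := AlgExt A X B Y) _ _ _ t z

@[simp]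
theorem leftE_coe (t : A ⊗[ℂ] B) (z : X ⊗[ℂ] Y) :
    leftE A X B Y (toTensor A B t) (toExt A X B Y z) = toExt A X B Y (leftT A X B Y t z) :=
  extendBilin_coe (E := AlgTensor A B) (F := AlgExt A X B Y) (G := AlgExt A X B Y) _ _ _ t z

theorem exists_ipE_self (z : ExtTensor A X B Y) :
    ∃ b : CStarTensor A B, ipE A X B Y z z = star b * b := by
  let _ : PartialOrder (CStarTensor A B) := CStarAlgebra.spectralOrder _
  have _ : StarOrderedRing (CStarTensor A B) := CStarAlgebra.spectralOrderedRing _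
  refine CStarAlgebra.nonneg_iff_eq_star_mul_self.1 ?_
  induction z using ext_induction with
  | hp => exact isClosed_le (by fun_prop) (by fun_prop)
  | ih z =>
    obtain ⟨n, s, hs⟩ := exists_ipT_self (A := A) (B := B) z
    rw [ipE_coe, hs, map_sum]
    refine Finset.sum_nonneg fun k _ => ?_
    rw [map_sum]
    refine Finset.sum_nonneg fun l _ => ?_
    rw [← mulC_coe, ← starC_coe]
    exact star_mul_self_nonneg (toTensor A B (s k l))

instance : HilbertModule (CStarTensor A B) (ExtTensor A X B Y) where
  act :=
    { toFun := fun t => (actE A X B Y t).toLinearMap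
      map_add' := fun s t => by rw [map_add]; rfl
      map_smul' := fun c t => by rw [map_smul]; rfl }
  ip :=
    { toFun := fun z => (ipE A X B Y z).toLinearMap
      map_add' := fun z w => by rw [map_add]; rfl
      map_smul' := fun c z => by rw [map_smulₛₗ]; rfl }
  act_mul s t z := by
    change actE A X B Y (mulC A B s t) z = actE A X B Y t (actE A X B Y s z)
    induction s using tensor_induction with
    | hp => exact isClosed_eq (by fun_prop) (by fun_prop)
    | ih s =>
      induction t using tensor_induction with
      | hp => exact isClosed_eq (by fun_prop) (by fun_prop)
      | ih t =>
        induction z using ext_induction with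
        | hp => exact isClosed_eq (by fun_prop) (by fun_prop)
        | ih z => simp [actT_mulT]
  ip_self z := exists_ipE_self A X B Y z
  star_ip z w := by
    change starC A B (ipE A X B Y z w) = ipE A X B Y w z
    induction z using ext_induction with
    | hp => exact isClosed_eq (by fun_prop) (by fun_prop)
    | ih z =>
      induction w using ext_induction with
      | hp => exact isClosed_eq (by fun_prop) (by fun_prop)
      | ih w => simp [starT_ipT]
  ip_act z w t := by
    change ipE A X B Y z (actE A X B Y t w) = mulC A B (ipE A X B Y z w) t
    induction z using ext_induction with
    | hp => exact isClosed_eq (by fun_prop) (by fun_prop)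
    | ih z =>
      induction w using ext_induction with
      | hp => exact isClosed_eq (by fun_prop) (by fun_prop)
      | ih w =>
        induction t using tensor_induction with
        | hp => exact isClosed_eq (by fun_prop) (by fun_prop)
        | ih t => simp [ipT_actT]
  norm_sq z := by
    change ‖z‖ ^ 2 = ‖ipE A X B Y z z‖
    induction z using ext_induction with
    | hp => exact isClosed_eq (by fun_prop) (by fun_prop)
    | ih z => rw [norm_toExt, ipE_coe, norm_toTensor, extNorm_sq]

/-- The external tensor product is a correspondence over the spatial tensor product. -/
instance : Correspondence (CStarTensor A B) (ExtTensor A X B Y) where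
  φ :=
    { toFun := fun t => leftE A X B Y t
      map_smul' := fun c t => map_smul _ c t
      map_zero' := map_zero _
      map_add' := fun s t => map_add _ s t
      map_mul' := fun s t => by
        refine ContinuousLinearMap.ext fun z => ?_
        change leftE A X B Y (mulC A B s t) z = leftE A X B Y s (leftE A X B Y t z)
        induction s using tensor_induction with
        | hp => exact isClosed_eq (by fun_prop) (by fun_prop)
        | ih s =>
          induction t using tensor_induction with
          | hp => exact isClosed_eq (by fun_prop) (by fun_prop)
          | ih t =>
            induction z using ext_induction with
            | hp => exact isClosed_eq (by fun_prop) (by fun_prop)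
            | ih z => simp [leftT_mulT] }
  ip_φ t z w := by
    change ipE A X B Y (leftE A X B Y t z) w = ipE A X B Y z (leftE A X B Y (starC A B t) w)
    induction z using ext_induction with
    | hp => exact isClosed_eq (by fun_prop) (by fun_prop)
    | ih z =>
      induction w using ext_induction with
      | hp => exact isClosed_eq (by fun_prop) (by fun_prop)
      | ih w =>
        induction t using tensor_induction with
        | hp => exact isClosed_eq (by fun_prop) (by fun_prop)
        | ih t => simp [ipT_leftT]

end Completed

end External

/-! ### Slice maps -/

section Slice

open scoped ComplexOrder in
/-- Every positive element of a unital C⋆-algebra is normed by a positive functional `f` with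
`f 1 = 1`. -/
theorem exists_state {B : Type v} [CStarAlgebra B] [PartialOrder B] [StarOrderedRing B]
    [Nontrivial B] (p : B) (hp : 0 ≤ p) : ∃ f : B →ₚ[ℂ] ℂ, f 1 = 1 ∧ f p = (‖p‖ : ℂ) := by
  have hx : ‖algebraMap ℝ B ‖p‖ + p‖ = ‖p‖ + ‖p‖ := by
    refine le_antisymm ?_ ?_
    · refine (norm_add_le _ _).trans ?_
      rw [norm_algebraMap', Real.norm_of_nonneg (norm_nonneg _)]
    · have h0 : 0 ≤ algebraMap ℝ B ‖p‖ + p :=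
        add_nonneg (algebraMap_nonneg B (norm_nonneg p)) hp
      have h1 := (CStarAlgebra.norm_le_iff_le_algebraMap (algebraMap ℝ B ‖p‖ + p)
        (norm_nonneg _) h0).1 le_rfl
      have h3 : ‖p‖ ≤ ‖algebraMap ℝ B ‖p‖ + p‖ :=
        CStarAlgebra.norm_le_norm_of_nonneg_of_le (a := p) hp
          (le_add_of_nonneg_left (algebraMap_nonneg B (norm_nonneg p)))
      have h2 : p ≤ algebraMap ℝ B (‖algebraMap ℝ B ‖p‖ + p‖ - ‖p‖) := by
        rw [map_sub, le_sub_iff_add_le, add_comm]; exact h1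
      have := (CStarAlgebra.norm_le_iff_le_algebraMap p (sub_nonneg.2 h3) hp).2 h2
      linarith
  obtain ⟨g, hg, hgx⟩ : ∃ g : StrongDual ℂ B, ‖g‖ ≤ 1 ∧ g 1 = 1 ∧ g p = (‖p‖ : ℂ) := by
    by_cases hp0 : ‖p‖ = 0
    · obtain ⟨g, hg, h⟩ := exists_dual_vector'' ℂ (1 : B)
      refine ⟨g, hg, by simpa using h, ?_⟩
      rw [norm_eq_zero.1 hp0]; simp
    · obtain ⟨g, hg, h⟩ := exists_dual_vector'' ℂ (algebraMap ℝ B ‖p‖ + p)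
      have hp1 : 0 < ‖p‖ := lt_of_le_of_ne (norm_nonneg _) (Ne.symm hp0)
      have e1 : ‖g 1‖ ≤ 1 := (g.le_opNorm 1).trans (by simpa using hg)
      have e2 : ‖g p‖ ≤ ‖p‖ := (g.le_opNorm p).trans
        (mul_le_of_le_one_left (norm_nonneg _) hg)
      have e : (‖p‖ : ℂ) * g 1 + g p = ((‖p‖ + ‖p‖ : ℝ) : ℂ) := by
        have h' : algebraMap ℝ B ‖p‖ = (‖p‖ : ℂ) • (1 : B) := by
          rw [Algebra.algebraMap_eq_smul_one, Complex.coe_smul]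
        rw [hx, h', map_add, map_smul, smul_eq_mul] at h
        exact h
      have er := congrArg Complex.re e
      simp only [Complex.add_re, Complex.re_ofReal_mul, Complex.ofReal_re] at er
      have r1 := (Complex.re_le_norm (g 1)).trans e1
      have r2 := (Complex.re_le_norm (g p)).trans e2
      have s2 : (g p).re = ‖p‖ := by nlinarith
      have s1 : (g 1).re = 1 := by
        have : ‖p‖ * (g 1).re = ‖p‖ * 1 := by linarith
        exact mul_left_cancel₀ hp0 this
      refine ⟨g, hg, ?_, ?_⟩
      · have := (Complex.re_eq_norm (z := g 1)).1 (le_antisymm (Complex.re_le_norm _)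
          (e1.trans s1.ge))
        refine Complex.ext s1 ?_
        simpa using (Complex.nonneg_iff.1 this).2.symm
      · have := (Complex.re_eq_norm (z := g p)).1 (le_antisymm (Complex.re_le_norm _)
          (e2.trans s2.ge))
        refine Complex.ext (by simpa using s2) ?_
        simpa using (Complex.nonneg_iff.1 this).2.symm
  refine ⟨PositiveLinearMap.mk₀ g.toLinearMap fun a ha => ?_, hgx.1, hgx.2⟩
  change 0 ≤ g a
  have hsa : IsSelfAdjoint a := .of_nonneg ha
  refine Complex.nonneg_iff.2 ⟨?_, ?_⟩
  · have hn : ‖algebraMap ℝ B ‖a‖ - a‖ ≤ ‖a‖ := by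
      refine (CStarAlgebra.norm_le_iff_le_algebraMap _ (norm_nonneg _)
        (sub_nonneg.2 hsa.le_algebraMap_norm_self)).2 ?_
      exact sub_le_self _ ha
    have h' : algebraMap ℝ B ‖a‖ = (‖a‖ : ℂ) • (1 : B) := by
      rw [Algebra.algebraMap_eq_smul_one, Complex.coe_smul]
    have h1 : ‖g (algebraMap ℝ B ‖a‖ - a)‖ ≤ ‖a‖ :=
      (g.le_opNorm _).trans ((mul_le_of_le_one_left (norm_nonneg _) hg).trans hn)
    rw [h', map_sub, map_smul, hgx.1, smul_eq_mul, mul_one] at h1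
    have := (Complex.re_le_norm _).trans h1
    simp only [Complex.sub_re, Complex.ofReal_re] at this
    linarith
  · have key : ∀ t : ℝ, ((g a).im + t) ^ 2 ≤ ‖a‖ ^ 2 + t ^ 2 := fun t => by
      have h1 : ‖a + (Complex.I * t) • (1 : B)‖ ^ 2 ≤ ‖a‖ ^ 2 + t ^ 2 := by
        have e : star (a + (Complex.I * t) • (1 : B)) * (a + (Complex.I * t) • (1 : B))
            = a * a + ((t : ℂ) ^ 2) • (1 : B) := by
          rw [star_add, hsa.star_eq, star_smul, star_one]
          simp only [add_mul, mul_add, smul_mul_assoc, mul_smul_comm, one_mul, mul_one,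
            star_mul', Complex.star_def, Complex.conj_I, Complex.conj_ofReal]
          have : Complex.I * t * (-Complex.I * t) = (t : ℂ) ^ 2 := by
            linear_combination (-(t : ℂ) ^ 2) * Complex.I_sq
          rw [smul_add, smul_smul, this]
          module
        rw [sq, ← CStarRing.norm_star_mul_self, e]
        refine (norm_add_le _ _).trans (add_le_add ?_ ?_)
        · rw [sq]; exact norm_mul_le _ _
        · rw [norm_smul]; simp
      have h2 : ‖g (a + (Complex.I * t) • (1 : B))‖ ≤ ‖a + (Complex.I * t) • (1 : B)‖ :=
        (g.le_opNorm _).trans (mul_le_of_le_one_left (norm_nonneg _) hg)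
      have h3 := Complex.abs_im_le_norm (g (a + (Complex.I * t) • (1 : B)))
      rw [map_add, map_smul, hgx.1, smul_eq_mul, mul_one] at h2 h3
      simp only [Complex.add_im, Complex.mul_im, Complex.I_re,
        Complex.I_im, Complex.ofReal_re, Complex.ofReal_im, zero_mul, one_mul, zero_add] at h3
      refine le_trans ?_ h1
      rw [← sq_abs]
      exact pow_le_pow_left₀ (abs_nonneg _) (h3.trans h2) 2
    by_contra hne
    have hne' : (g a).im ≠ 0 := fun h => hne h.symm
    have := key ((‖a‖ ^ 2 + 1) / (g a).im)
    have e : (g a).im * ((‖a‖ ^ 2 + 1) / (g a).im) = ‖a‖ ^ 2 + 1 := by field_simp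
    nlinarith [sq_nonneg (g a).im, sq_nonneg ‖a‖]

/-- Every element of a C⋆-algebra is normed by a Hilbert space representation. -/
theorem exists_norm_le_rep {B : Type v} [NonUnitalCStarAlgebra B] (b : B) :
    ∃ ρ : HilbertRep B, ‖b‖ ≤ ‖ρ.rep b‖ := by
  let _ : PartialOrder (Unitization ℂ B) := CStarAlgebra.spectralOrder _
  have _ : StarOrderedRing (Unitization ℂ B) := CStarAlgebra.spectralOrderedRing _
  obtain ⟨f, hf1, hfp⟩ := exists_state (star (b : Unitization ℂ B) * b) (star_mul_self_nonneg _)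
  refine ⟨⟨f.GNS, f.gnsNonUnitalStarAlgHom.comp (Unitization.inrNonUnitalStarAlgHom ℂ B)⟩, ?_⟩
  set T := f.gnsNonUnitalStarAlgHom (b : Unitization ℂ B) with hT
  change ‖b‖ ≤ ‖T‖
  have h1 : ‖(f.toPreGNS 1 : f.GNS)‖ = 1 := by
    rw [Completion.norm_coe, PositiveLinearMap.preGNS_norm_def]
    simp [hf1]
  have h2 : ‖T (f.toPreGNS 1 : f.GNS)‖ = ‖b‖ := by
    rw [hT, PositiveLinearMap.gnsNonUnitalStarAlgHom_apply_coe, Completion.norm_coe,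
      PositiveLinearMap.preGNS_norm_def]
    have : f.ofPreGNS (f.leftMulMapPreGNS (b : Unitization ℂ B) (f.toPreGNS 1))
        = (b : Unitization ℂ B) := by simp
    rw [this, hfp, Complex.ofReal_re, CStarRing.norm_star_mul_self, Unitization.norm_inr]
    exact Real.sqrt_mul_self (norm_nonneg _)
  have := T.le_opNorm (f.toPreGNS 1 : f.GNS)
  rwa [h1, h2, mul_one] at this

theorem opNorm_le_of_inner_le {H : Type*} [NormedAddCommGroup H] [InnerProductSpace ℂ H]
    (T : H →L[ℂ] H) {C : ℝ} (hC : 0 ≤ C) (h : ∀ x y, ‖⟪x, T y⟫_ℂ‖ ≤ C * ‖x‖ * ‖y‖) :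
    ‖T‖ ≤ C := by
  refine T.opNorm_le_bound hC fun y => ?_
  have := (Complex.re_le_norm _).trans (h (T y) y)
  have e : (⟪T y, T y⟫_ℂ).re = ‖T y‖ ^ 2 := inner_self_eq_norm_sq (𝕜 := ℂ) (T y)
  rw [e] at this
  rcases (norm_nonneg (T y)).eq_or_lt with h0 | h0
  · rw [← h0]; positivity
  · refine le_of_mul_le_mul_left ?_ h0
    nlinarith

variable {A : Type u} {B : Type v} [NonUnitalCStarAlgebra A] [NonUnitalCStarAlgebra B]

/-- The map `f ⊗ id` on the algebraic tensor product. -/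
def leftSliceT (f : A →ₗ[ℂ] ℂ) : A ⊗[ℂ] B →ₗ[ℂ] B :=
  (TensorProduct.lid ℂ B).toLinearMap ∘ₗ LinearMap.rTensor B f

variable (A) in
/-- The map `id ⊗ ω` on the algebraic tensor product. -/
def sliceT (ω : B →ₗ[ℂ] ℂ) : A ⊗[ℂ] B →ₗ[ℂ] A :=
  (TensorProduct.rid ℂ A).toLinearMap ∘ₗ LinearMap.lTensor A ω

@[simp]
theorem leftSliceT_tmul (f : A →ₗ[ℂ] ℂ) (a : A) (b : B) :
    leftSliceT f (a ⊗ₜ[ℂ] b) = f a • b := by simp [leftSliceT]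

@[simp]
theorem sliceT_tmul (ω : B →ₗ[ℂ] ℂ) (a : A) (b : B) :
    sliceT A ω (a ⊗ₜ[ℂ] b) = ω b • a := by simp [sliceT]

/-- The functional `a ↦ ⟨x, π(a) y⟩`. -/
def HilbertRep.coeff (π : HilbertRep A) (x y : π.H) : A →ₗ[ℂ] ℂ where
  toFun a := ⟪x, π.rep a y⟫_ℂ
  map_add' a b := by rw [map_add, add_apply, inner_add_right]
  map_smul' c a := by rw [map_smul, smul_apply, inner_smul_right]; rfl

theorem HilbertRep.coeff_apply (π : HilbertRep A) (x y : π.H) (a : A) :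
    π.coeff x y a = ⟪x, π.rep a y⟫_ℂ := rfl

theorem inner_leftSliceT (π : HilbertRep A) (ρ : HilbertRep B) (x y : π.H) (x' y' : ρ.H)
    (t : A ⊗[ℂ] B) : ⟪x', ρ.rep (leftSliceT (π.coeff x y) t) y'⟫_ℂ
      = ⟪x ⊗ₜ[ℂ] x', π.tensor ρ t (y ⊗ₜ[ℂ] y')⟫_ℂ := by
  induction t using TensorProduct.induction_on with
  | zero => simp
  | add t t' h h' => simp only [map_add, add_apply, inner_add_right, h, h']
  | tmul a b =>
    rw [leftSliceT_tmul, map_smul, smul_apply, inner_smul_right, HilbertRep.tensor_tmul,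
      TensorProduct.mapL_tmul, TensorProduct.inner_tmul, HilbertRep.coeff_apply]

theorem norm_leftSliceT_le (π : HilbertRep A) (x y : π.H) (t : A ⊗[ℂ] B) :
    ‖leftSliceT (π.coeff x y) t‖ ≤ spatialNorm t * ‖x‖ * ‖y‖ := by
  obtain ⟨ρ, hρ⟩ := exists_norm_le_rep (leftSliceT (π.coeff x y) t)
  refine hρ.trans (opNorm_le_of_inner_le _ (mul_nonneg (mul_nonneg (spatialNorm_nonneg t)
    (norm_nonneg _)) (norm_nonneg _)) fun x' y' => ?_)
  rw [inner_leftSliceT]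
  refine (norm_inner_le_norm (x ⊗ₜ[ℂ] x') (π.tensor ρ t (y ⊗ₜ[ℂ] y'))).trans ?_
  have h1 := ((π.tensor ρ t).le_opNorm (y ⊗ₜ[ℂ] y')).trans
    (mul_le_mul_of_nonneg_right (norm_tensor_le π ρ t) (norm_nonneg _))
  rw [TensorProduct.norm_tmul] at h1 ⊢
  calc ‖x‖ * ‖x'‖ * ‖π.tensor ρ t (y ⊗ₜ[ℂ] y')‖
      ≤ ‖x‖ * ‖x'‖ * (spatialNorm t * (‖y‖ * ‖y'‖)) :=
        mul_le_mul_of_nonneg_left h1 (by positivity)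
    _ = _ := by ring

theorem inner_sliceT (π : HilbertRep A) (ω : B →ₗ[ℂ] ℂ) (x y : π.H) (t : A ⊗[ℂ] B) :
    ⟪x, π.rep (sliceT A ω t) y⟫_ℂ = ω (leftSliceT (π.coeff x y) t) := by
  induction t using TensorProduct.induction_on with
  | zero => simp
  | add t t' h h' => simp only [map_add, add_apply, inner_add_right, h, h']
  | tmul a b =>
    rw [leftSliceT_tmul, sliceT_tmul, map_smul, map_smul, smul_apply, inner_smul_right,
      HilbertRep.coeff_apply, smul_eq_mul, mul_comm]

theorem norm_sliceT_le (ω : StrongDual ℂ B) (t : A ⊗[ℂ] B) :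
    ‖sliceT A (ω : B →ₗ[ℂ] ℂ) t‖ ≤ ‖ω‖ * spatialNorm t := by
  obtain ⟨π, hπ⟩ := exists_norm_le_rep (sliceT A (ω : B →ₗ[ℂ] ℂ) t)
  refine hπ.trans (opNorm_le_of_inner_le _ (mul_nonneg (norm_nonneg _) (spatialNorm_nonneg t))
    fun x y => ?_)
  rw [inner_sliceT]
  refine (ω.le_opNorm _).trans ?_
  rw [mul_assoc, mul_assoc]
  refine mul_le_mul_of_nonneg_left ?_ (norm_nonneg _)
  rw [← mul_assoc]
  exact norm_leftSliceT_le π x y t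

variable (A) in
/-- The slice map `id ⊗ ω` on the spatial tensor product, for `ω` in the dual of `B`. -/
def slice (ω : StrongDual ℂ B) : CStarTensor A B →L[ℂ] A :=
  ContinuousLinearMap.fromCompletion (α := AlgTensor A B) <|
    LinearMap.mkContinuous (E := AlgTensor A B) (sliceT A (ω : B →ₗ[ℂ] ℂ)) ‖ω‖
      (norm_sliceT_le ω)

theorem slice_coe (ω : StrongDual ℂ B) (t : A ⊗[ℂ] B) :
    slice A ω (toTensor A B t) = sliceT A (ω : B →ₗ[ℂ] ℂ) t :=
  ContinuousLinearMap.fromCompletion_apply_coe (α := AlgTensor A B) _ t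

theorem slice_elem (ω : StrongDual ℂ B) (a : A) (b : B) :
    slice A ω (elem a b) = ω b • a :=
  (slice_coe ω _).trans (sliceT_tmul _ a b)

end Slice

/-! ### Compact operators, Katsura's ideal, the slice map property -/

section Ideals

open HilbertModule Correspondence

section

variable (A X : Type*) [NonUnitalCStarAlgebra A] [NormedAddCommGroup X] [NormedSpace ℂ X]
  [CompleteSpace X]

/-- The compact operators on a Hilbert module: the closed linear span of the rank-one operators
`z ↦ x · ⟨y, z⟩`. -/
def compacts [HilbertModule A X] : Submodule ℂ (X →L[ℂ] X) :=
  (Submodule.span ℂ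
    {T : X →L[ℂ] X | ∃ x y : X, ∀ z : X, T z = act (ip y z : A) x}).topologicalClosure

/-- The Katsura ideal `J_X` of a correspondence `X`: all `a` with `φ a` compact and `a * b = 0`
for every `b` in the kernel of `φ`. -/
def katsuraIdeal [Correspondence A X] : Submodule ℂ A where
  carrier := {a | φ a ∈ compacts A X ∧ ∀ b : A, (φ b : X →L[ℂ] X) = 0 → a * b = 0}
  zero_mem' := ⟨by rw [map_zero]; exact zero_mem _, fun b _ => zero_mul b⟩
  add_mem' h k := ⟨by rw [map_add]; exact add_mem h.1 k.1, fun b hb => by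
    rw [add_mul, h.2 b hb, k.2 b hb, add_zero]⟩
  smul_mem' c a h := ⟨by rw [map_smul]; exact Submodule.smul_mem _ c h.1, fun b hb => by
    rw [smul_mul_assoc, h.2 b hb, smul_zero]⟩

end

section

variable {A : Type u} {B : Type v} [NonUnitalCStarAlgebra A] [NonUnitalCStarAlgebra B]

/-- The tensor product `C ⊗ D` inside the spatial tensor product: the closed linear span of the
elementary tensors `c ⊗ d` with `c ∈ C` and `d ∈ D`. -/
def tensorSub (C : Submodule ℂ A) (D : Submodule ℂ B) : Submodule ℂ (CStarTensor A B) :=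
  (Submodule.span ℂ {x | ∃ c ∈ C, ∃ d ∈ D, x = elem c d}).topologicalClosure

variable (B) in
/-- The slice map property of the triple `(C, A, B)`. -/
def SliceMapProperty (C : Submodule ℂ A) : Prop :=
  (tensorSub C (⊤ : Submodule ℂ B) : Set (CStarTensor A B))
    = {x | ∀ ω : StrongDual ℂ B, slice A ω x ∈ C}

end

/-- A left `B`-valued inner product `ℓ` that makes the correspondence `Y` over `B` an
imprimitivity bimodule: `Y` is a full left and a full right Hilbert module, and the two inner
products satisfy `ℓ(x, y) · z = x · ⟨y, z⟩`. The norm defined by `ℓ` then agrees with the norm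
of `Y`, so that completeness for it need not be required separately. -/
structure IsLeftInnerProduct {B Y : Type*} [NonUnitalCStarAlgebra B] [NormedAddCommGroup Y]
    [NormedSpace ℂ Y] [CompleteSpace Y] [Correspondence B Y]
    (l : Y →ₗ[ℂ] Y →ₗ⋆[ℂ] B) : Prop where
  left_mul : ∀ (b : B) (x y : Y), l (φ b x) y = b * l x y
  star_symm : ∀ x y : Y, star (l x y) = l y x
  positive : ∀ x : Y, ∃ b : B, l x x = star b * b
  definite : ∀ x : Y, l x x = 0 → x = 0
  right_adjoint : ∀ (b : B) (x y : Y), l (act b x) y = l x (act (star b) y)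
  compatible : ∀ x y z : Y, φ (l x y) z = act (ip y z : B) x
  left_full : (Submodule.span ℂ {b : B | ∃ x y : Y, b = l x y}).topologicalClosure = ⊤
  right_full : (Submodule.span ℂ {b : B | ∃ x y : Y, b = ip x y}).topologicalClosure = ⊤

/-- The correspondence `Y` over `B` is an imprimitivity bimodule. -/
def IsImprimitivityBimodule (B Y : Type*) [NonUnitalCStarAlgebra B] [NormedAddCommGroup Y]
    [NormedSpace ℂ Y] [CompleteSpace Y] [Correspondence B Y] : Prop :=
  ∃ l : Y →ₗ[ℂ] Y →ₗ⋆[ℂ] B, IsLeftInnerProduct l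

/-- The correspondences `X` over `A` and `Y` over `B` are ideal-compatible:
`J_{X ⊗ Y} = J_X ⊗ J_Y`. -/
def IdealCompatible (A X : Type u) (B Y : Type v) [NonUnitalCStarAlgebra A]
    [NonUnitalCStarAlgebra B] [NormedAddCommGroup X] [NormedSpace ℂ X] [CompleteSpace X]
    [NormedAddCommGroup Y] [NormedSpace ℂ Y] [CompleteSpace Y]
    [Correspondence A X] [Correspondence B Y] : Prop :=
  katsuraIdeal (CStarTensor A B) (ExtTensor A X B Y)
    = tensorSub (katsuraIdeal A X) (katsuraIdeal B Y)

end Ideals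

end CStarCorrespondence

end

/-!
Let `l` be the left inner product of the imprimitivity bimodule `Y`. By compatibility `φ (l x y)`
is the rank-one operator of `x` and `y`, so by fullness the left action of `B` on `Y` is injective
and by compact operators, and `J_Y = B`. Both claims therefore reduce to `J_{X ⊗ Y} = J_X ⊗ B`.

Both inclusions use the same identity. For `ω` in the dual of `B`, the functional
`b ↦ ω (l(y, z) b l(u, v))` is of the form `b ↦ ψ (⟨z, φ(b) u⟩)`, so that slicing `w ∈ A ⊗ B` by it
gives an element of `A` whose action on `X` is a compression of the operator `φ w` on `X ⊗ Y`
(`exists_ip_φ_slice`). Elements of `B` are limits of linear combinations of elements `l(y, z)`, so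
these slices suffice.

* `J_{X ⊗ Y} ⊆ J_X ⊗ B` (`slice_mem_katsuraIdeal`): by the slice map property it is enough that
  the slices of `w ∈ J_{X ⊗ Y}` lie in `J_X`. Compressions of compact operators are compact
  (`mem_compacts_of_slice`), and for `φ k = 0` the product of a slice of `w` with `k` is a slice of
  `w (k ⊗ b) = 0`. An approximate unit of `A ⊗ B` leads from the special functionals to all of them.
* `J_X ⊗ B ⊆ J_{X ⊗ Y}` (`elem_mem_katsuraIdeal`): for `a ∈ J_X` and `b = l(y, z)` the operator
  `φ (a ⊗ b)` is the tensor product of a compact and a rank-one operator, hence compact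
  (`φ_elem_mem_compacts`); this needs the bound `‖S ⊗ T‖ ≤ ‖S‖ ‖T‖` for adjointable operators
  (`extNorm_opT_le`). If `φ w = 0`, then the special slices of `w` are in the kernel of the action
  on `X`, so they are annihilated by `a`; since slices separate points
  (`eq_zero_of_slice_eq_zero`), `(a ⊗ b) w = 0`.
-/

noncomputable section

namespace CStarCorrespondence

/-! ### Hilbert modules and rank-one operators -/

section HilbertModuleBasics

open HilbertModule Correspondence

variable {A X : Type*} [NonUnitalCStarAlgebra A] [NormedAddCommGroup X] [NormedSpace ℂ X]
  [CompleteSpace X]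

section

variable [HilbertModule A X]

variable (A) in
/-- The Cauchy-Schwarz inequality for Hilbert modules. -/
theorem norm_ip_le (x y : X) : ‖(ip x y : A)‖ ≤ ‖x‖ * ‖y‖ := by
  let _ : PartialOrder A := CStarAlgebra.spectralOrder A
  have _ : StarOrderedRing A := CStarAlgebra.spectralOrderedRing A
  rcases eq_or_ne x 0 with rfl | hx
  · simp
  have hs : 0 < ‖x‖ ^ 2 := by positivity
  set s : ℝ := ‖x‖ ^ 2 with hs_def
  set a : A := ip x y with ha
  have hyx : (ip y x : A) = star a := (star_ip x y).symm
  -- Expand `⟨z, z⟩ ≥ 0` for `z = x · ⟨x, y⟩ - ‖x‖² y`.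
  have hz : (ip (act a x - (s : ℂ) • y) (act a x - (s : ℂ) • y) : A)
      = star a * ip x x * a - s • (star a * a) - s • (star a * a) + s • s • ip y y := by
    simp only [map_sub, LinearMap.sub_apply, map_smulₛₗ, LinearMap.smul_apply, act_ip, ip_act,
      ← ha, hyx, Complex.conj_ofReal, RingHom.id_apply, mul_assoc]
    simp only [Complex.coe_smul, smul_sub]
    abel
  have h0 : 0 ≤ star a * ip x x * a - s • (star a * a) - s • (star a * a) + s • s • ip y y := by
    rw [← hz]
    obtain ⟨b, hb⟩ := ip_self (A := A) (act a x - (s : ℂ) • y)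
    rw [hb]
    exact star_mul_self_nonneg b
  have hsa : IsSelfAdjoint (ip x x : A) := star_ip x x
  have h1 : star a * ip x x * a ≤ s • (star a * a) := by
    have := CStarAlgebra.star_left_conjugate_le_norm_smul (a := a) (b := (ip x x : A))
    rwa [← norm_sq] at this
  have h2 : star a * a ≤ s • ip y y := by
    rw [← smul_le_smul_iff_of_pos_left hs, ← sub_nonneg]
    refine h0.trans ?_
    rw [← sub_nonneg] at h1 ⊢
    refine h1.trans_eq ?_
    abel
  have h3 := CStarAlgebra.norm_le_norm_of_nonneg_of_le (star_mul_self_nonneg a) h2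
  rw [CStarRing.norm_star_mul_self, norm_smul, ← norm_sq, Real.norm_of_nonneg hs.le, ← sq,
    ← mul_pow] at h3
  exact le_of_sq_le_sq h3 (by positivity)

theorem norm_act_le (a : A) (x : X) : ‖(act a x : X)‖ ≤ ‖a‖ * ‖x‖ := by
  refine le_of_sq_le_sq ?_ (by positivity)
  rw [norm_sq (A := A), ip_act, act_ip, mul_pow, norm_sq (A := A) x]
  calc ‖star a * ip x x * a‖ ≤ ‖star a‖ * ‖(ip x x : A)‖ * ‖a‖ :=
        (norm_mul_le _ _).trans (by gcongr; exact norm_mul_le _ _)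
    _ = _ := by rw [norm_star]; ring

variable (A X) in
/-- The inner product as a continuous sesquilinear map. -/
def ipL : X →L⋆[ℂ] X →L[ℂ] A :=
  LinearMap.mkContinuous₂ ip 1 fun x y => by rw [one_mul]; exact norm_ip_le A x y

@[simp]
theorem ipL_apply (x y : X) : ipL A X x y = ip x y := rfl

variable (A X) in
/-- The right action as a continuous bilinear map. -/
def actL : A →L[ℂ] X →L[ℂ] X :=
  LinearMap.mkContinuous₂ act 1 fun a x => by rw [one_mul]; exact norm_act_le a x

@[simp]
theorem actL_apply (a : A) (x : X) : actL A X a x = act a x := rfl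

theorem ext_ip {x y : X} (h : ∀ z : X, (ip z x : A) = ip z y) : x = y := by
  have h0 : (ip (x - y) (x - y) : A) = 0 := by
    rw [map_sub (ip (x - y) : X →ₗ[ℂ] A), h, sub_self]
  rw [← sub_eq_zero, ← norm_eq_zero, ← sq_eq_zero_iff, norm_sq (A := A), h0, norm_zero]

/-- Operators on a Hilbert module are normed by their matrix coefficients. -/
theorem opNorm_le_of_ip_le {T : X →L[ℂ] X} {C : ℝ} (hC : 0 ≤ C)
    (h : ∀ x y, ‖(ip x (T y) : A)‖ ≤ C * ‖x‖ * ‖y‖) : ‖T‖ ≤ C := by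
  refine T.opNorm_le_bound hC fun y => ?_
  have := h (T y) y
  rw [← norm_sq] at this
  rcases (norm_nonneg (T y)).eq_or_lt with h0 | h0
  · rw [← h0]; positivity
  · refine le_of_mul_le_mul_left ?_ h0
    nlinarith

/-- Adjoint operators on a Hilbert module have the same norm. -/
theorem norm_le_of_adjoint {S T : X →L[ℂ] X} (h : ∀ x y, (ip (S x) y : A) = ip x (T y)) :
    ‖T‖ ≤ ‖S‖ := by
  refine opNorm_le_of_ip_le (A := A) (norm_nonneg _) fun x y => ?_
  rw [← h]
  refine (norm_ip_le A _ _).trans ?_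
  gcongr
  exact S.le_opNorm x

variable (A X) in
/-- The rank-one operators `z ↦ x · ⟨y, z⟩`, as a continuous sesquilinear map of `x` and `y`. -/
def rankOne : X →L[ℂ] X →L⋆[ℂ] (X →L[ℂ] X) :=
  LinearMap.mkContinuous₂
    (LinearMap.mk₂'ₛₗ (RingHom.id ℂ) (starRingEnd ℂ)
      (fun x y => (actL A X).flip x ∘L ipL A X y)
      (fun x x' y => by ext z; simp)
      (fun c x y => by ext z; simp)
      (fun x y y' => by ext z; simp)
      (fun c x y => by ext z; simp))
    1 fun x y => by
      refine ContinuousLinearMap.opNorm_le_bound _ (by positivity) fun z => ?_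
      change ‖(act (ip y z : A) x : X)‖ ≤ _
      refine (norm_act_le _ _).trans ?_
      have := mul_le_mul_of_nonneg_right (norm_ip_le A y z) (norm_nonneg x)
      linarith

@[simp]
theorem rankOne_apply (x y z : X) : rankOne A X x y z = act (ip y z : A) x := rfl

theorem rankOne_adjoint (x y z w : X) :
    (ip (rankOne A X x y z) w : A) = ip z (rankOne A X y x w) := by
  rw [rankOne_apply, rankOne_apply, act_ip, ip_act, star_ip]

theorem compacts_eq : compacts A X =
    (Submodule.span ℂ {T : X →L[ℂ] X | ∃ x y : X, T = rankOne A X x y}).topologicalClosure := by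
  unfold compacts
  congr 2
  ext T
  simp only [Set.mem_ofPred_eq, ContinuousLinearMap.ext_iff, rankOne_apply]

theorem rankOne_mem_compacts (x y : X) : rankOne A X x y ∈ compacts A X := by
  rw [compacts_eq]
  exact Submodule.le_topologicalClosure _ (Submodule.subset_span ⟨x, y, rfl⟩)

theorem isClosed_compacts : IsClosed (compacts A X : Set (X →L[ℂ] X)) :=
  Submodule.isClosed_topologicalClosure _

theorem compacts_le {M : Submodule ℂ (X →L[ℂ] X)} (hM : IsClosed (M : Set (X →L[ℂ] X)))
    (h : ∀ x y, rankOne A X x y ∈ M) : compacts A X ≤ M := by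
  rw [compacts_eq]
  refine Submodule.topologicalClosure_minimal _ (Submodule.span_le.2 ?_) hM
  rintro _ ⟨x, y, rfl⟩
  exact h x y

end

section

variable [Correspondence A X]

/-- The left action is contractive: with `r` as in `exists_quasi_sqrt`, the element
`‖a‖ ^ 2 ⟨x, x⟩ - ⟨φ(a) x, φ(a) x⟩` is the inner product of `‖a‖ x + φ(r) x` with itself. -/
theorem norm_φ_le (a : A) : ‖(φ a : X →L[ℂ] X)‖ ≤ ‖a‖ := by
  let _ : PartialOrder A := CStarAlgebra.spectralOrder A
  have _ : StarOrderedRing A := CStarAlgebra.spectralOrderedRing A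
  obtain ⟨r, hr, h⟩ := exists_quasi_sqrt a
  refine ContinuousLinearMap.opNorm_le_bound _ (norm_nonneg a) fun x => ?_
  have e : (ip ((‖a‖ : ℂ) • x + φ r x) ((‖a‖ : ℂ) • x + φ r x) : A)
      = ‖a‖ ^ 2 • ip x x - ip (φ a x) (φ a x) := by
    have h1 : (ip (φ a x) (φ a x) : A) = -ip x (φ ((2 * ‖a‖) • r + r * r) x) := by
      rw [h, ip_φ, ← mul_apply_eq_comp, ← map_mul]; simp
    have h2 : (ip (φ r x) x : A) = ip x (φ r x) := by rw [ip_φ, hr.star_eq]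
    have h3 : (ip (φ r x) (φ r x) : A) = ip x (φ (r * r) x) := by
      rw [ip_φ, hr.star_eq, map_mul]; rfl
    rw [h1, ← Complex.coe_smul (2 * ‖a‖) r]
    simp only [map_add, map_smulₛₗ, LinearMap.add_apply, LinearMap.smul_apply, h2, h3, add_apply,
      smul_apply, Complex.conj_ofReal, RingHom.id_apply]
    simp only [Complex.coe_smul, smul_add, two_mul, add_smul, sq, mul_smul]
    abel
  obtain ⟨b, hb⟩ := ip_self (A := A) ((‖a‖ : ℂ) • x + φ r x)
  obtain ⟨c, hc⟩ := ip_self (A := A) (φ a x)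
  have h1 : (ip (φ a x) (φ a x) : A) ≤ ‖a‖ ^ 2 • ip x x := by
    rw [← sub_nonneg, ← e, hb]; exact star_mul_self_nonneg b
  have h2 := CStarAlgebra.norm_le_norm_of_nonneg_of_le (hc ▸ star_mul_self_nonneg c) h1
  rw [← norm_sq, norm_smul, ← norm_sq, Real.norm_of_nonneg (by positivity), ← mul_pow] at h2
  exact le_of_sq_le_sq h2 (by positivity)

variable (A X) in
/-- The left action as a continuous linear map. -/
def φL : A →L[ℂ] (X →L[ℂ] X) :=
  LinearMap.mkContinuous
    { toFun := fun a => φ a, map_add' := map_add φ, map_smul' := fun c a => map_smul φ c a } 1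
    fun a => by rw [one_mul]; exact norm_φ_le a

@[simp]
theorem φL_apply (a : A) : φL A X a = φ a := rfl

theorem φ_mul_rankOne (a : A) (x y : X) :
    φ a * rankOne A X x y = rankOne A X (φ a x) y := by
  ext z
  refine ext_ip (A := A) fun w => ?_
  simp only [mul_apply_eq_comp, rankOne_apply]
  rw [← star_star a, ← ip_φ, ip_act, ip_act, ip_φ]

theorem rankOne_mul_φ (a : A) (x y : X) :
    rankOne A X x y * φ a = rankOne A X x (φ (star a) y) := by
  ext z
  simp only [mul_apply_eq_comp, rankOne_apply]
  rw [ip_φ, star_star]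

theorem φ_mul_mem_compacts (a : A) {T : X →L[ℂ] X} (hT : T ∈ compacts A X) :
    φ a * T ∈ compacts A X :=
  compacts_le (M := (compacts A X).comap (LinearMap.mulLeft ℂ (φ a : X →L[ℂ] X)))
    (isClosed_compacts.preimage (continuous_const.mul continuous_id))
    (fun x y => by
      rw [Submodule.mem_comap, LinearMap.mulLeft_apply, φ_mul_rankOne]
      exact rankOne_mem_compacts _ _) hT

theorem mul_φ_mem_compacts (a : A) {T : X →L[ℂ] X} (hT : T ∈ compacts A X) :
    T * φ a ∈ compacts A X :=
  compacts_le (M := (compacts A X).comap (LinearMap.mulRight ℂ (φ a : X →L[ℂ] X)))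
    (isClosed_compacts.preimage (continuous_id.mul continuous_const))
    (fun x y => by
      rw [Submodule.mem_comap, LinearMap.mulRight_apply, rankOne_mul_φ]
      exact rankOne_mem_compacts _ _) hT

theorem isClosed_katsuraIdeal : IsClosed (katsuraIdeal A X : Set A) := by
  have : (katsuraIdeal A X : Set A) = φL A X ⁻¹' (compacts A X) ∩
      ⋂ (b : A) (_ : (φ b : X →L[ℂ] X) = 0), {a | a * b = 0} := by
    ext a
    simp only [Set.mem_inter_iff, Set.mem_iInter]
    rfl
  rw [this]
  exact (isClosed_compacts.preimage (φL A X).continuous).inter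
    (isClosed_biInter fun b _ => isClosed_eq (by fun_prop) (by fun_prop))

theorem mul_mem_katsuraIdeal_left (a : A) {b : A} (hb : b ∈ katsuraIdeal A X) :
    a * b ∈ katsuraIdeal A X :=
  ⟨by rw [map_mul]; exact φ_mul_mem_compacts a hb.1, fun c hc => by
    rw [mul_assoc, hb.2 c hc, mul_zero]⟩

theorem mul_mem_katsuraIdeal_right {a : A} (b : A) (ha : a ∈ katsuraIdeal A X) :
    a * b ∈ katsuraIdeal A X :=
  ⟨by rw [map_mul]; exact mul_φ_mem_compacts b ha.1, fun c hc => by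
    rw [mul_assoc, ha.2 _ (by rw [map_mul, hc, mul_zero])]⟩

end

end HilbertModuleBasics

/-! ### Elementary tensors and slice maps -/

section SliceBasics

variable {A : Type u} {B : Type v} [NonUnitalCStarAlgebra A] [NonUnitalCStarAlgebra B]

theorem elem_mul_elem (a c : A) (b d : B) :
    (elem a b * elem c d : CStarTensor A B) = elem (a * c) (b * d) :=
  (mulC_coe A B (a ⊗ₜ b) (c ⊗ₜ d)).trans (by rw [mulT_tmul]; rfl)

theorem norm_elem_le (a : A) (b : B) : ‖(elem a b : CStarTensor A B)‖ ≤ ‖a‖ * ‖b‖ :=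
  (norm_toTensor A B _).trans_le (spatialNorm_tmul_le a b)

variable (A B) in
/-- The continuous bilinear map `(a, b) ↦ a ⊗ b`. -/
def elemL : A →L[ℂ] B →L[ℂ] CStarTensor A B :=
  LinearMap.mkContinuous₂
    (LinearMap.mk₂ ℂ (fun a b => (elem a b : CStarTensor A B))
      (fun a a' b => by simp only [elem, TensorProduct.add_tmul, map_add])
      (fun c a b => by
        rw [elem, ← TensorProduct.smul_tmul', map_smul, elem])
      (fun a b b' => by simp only [elem, TensorProduct.tmul_add, map_add])
      (fun c a b => by rw [elem, TensorProduct.tmul_smul, map_smul, elem]))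
    1 fun a b => by rw [one_mul]; exact norm_elem_le a b

/-- A closed subspace contains `a ⊗ b` for all `b` as soon as it does so for `b` in a set whose
linear span is dense. -/
theorem elem_mem_of_dense {M : Submodule ℂ (CStarTensor A B)}
    (hM : IsClosed (M : Set (CStarTensor A B))) {S : Set B}
    (hS : (Submodule.span ℂ S).topologicalClosure = ⊤) {a : A} (h : ∀ b ∈ S, elem a b ∈ M)
    (b : B) : elem a b ∈ M := by
  have : (Submodule.span ℂ S).topologicalClosure ≤ M.comap (elemL A B a).toLinearMap :=
    Submodule.topologicalClosure_minimal _ (Submodule.span_le.2 h)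
      (hM.preimage (elemL A B a).continuous)
  rw [hS] at this
  exact this (Submodule.mem_top (x := b))

theorem mem_of_elem_mem {M : Submodule ℂ (CStarTensor A B)}
    (hM : IsClosed (M : Set (CStarTensor A B))) (h : ∀ a b, elem a b ∈ M)
    (x : CStarTensor A B) : x ∈ M := by
  induction x using tensor_induction with
  | hp => exact hM
  | ih t =>
    induction t using TensorProduct.induction_on with
    | zero => rw [map_zero]; exact zero_mem M
    | tmul a b => exact h a b
    | add s t hs ht => rw [map_add]; exact add_mem hs ht

theorem clm_ext_elem {E : Type*} [NormedAddCommGroup E] [NormedSpace ℂ E]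
    {f g : CStarTensor A B →L[ℂ] E} (h : ∀ a b, f (elem a b) = g (elem a b)) : f = g := by
  ext x
  exact mem_of_elem_mem (M := LinearMap.eqLocus f.toLinearMap g.toLinearMap)
    (isClosed_eq f.continuous g.continuous) h x

theorem slice_elem_mul (ω : StrongDual ℂ B) (c : A) (d : B) (x : CStarTensor A B) :
    slice A ω (elem c d * x) = c * slice A (ω ∘L ContinuousLinearMap.mul ℂ B d) x := by
  have : slice A ω ∘L ContinuousLinearMap.mul ℂ (CStarTensor A B) (elem c d)
      = ContinuousLinearMap.mul ℂ A c ∘L slice A (ω ∘L ContinuousLinearMap.mul ℂ B d) :=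
    clm_ext_elem fun a b => by
      simp only [ContinuousLinearMap.comp_apply, ContinuousLinearMap.mul_apply', elem_mul_elem,
        slice_elem, mul_smul_comm]
  exact DFunLike.congr_fun this x

theorem slice_mul_elem (ω : StrongDual ℂ B) (c : A) (d : B) (x : CStarTensor A B) :
    slice A ω (x * elem c d) = slice A (ω ∘L (ContinuousLinearMap.mul ℂ B).flip d) x * c := by
  have : slice A ω ∘L (ContinuousLinearMap.mul ℂ (CStarTensor A B)).flip (elem c d)
      = (ContinuousLinearMap.mul ℂ A).flip c ∘L
        slice A (ω ∘L (ContinuousLinearMap.mul ℂ B).flip d) :=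
    clm_ext_elem fun a b => by
      simp only [ContinuousLinearMap.comp_apply, ContinuousLinearMap.flip_apply,
        ContinuousLinearMap.mul_apply', elem_mul_elem, slice_elem, smul_mul_assoc]
  exact DFunLike.congr_fun this x

/-- The coefficient functional of `π ⊗ ρ` at `ξ` and `η`, extended to the spatial tensor
product. -/
theorem exists_coeff (π : HilbertRep A) (ρ : HilbertRep B) (ξ η : π.H ⊗[ℂ] ρ.H) :
    ∃ f : StrongDual ℂ (CStarTensor A B),
      (∀ t, f (toTensor A B t) = ⟪ξ, π.tensor ρ t η⟫_ℂ) ∧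
      ∀ x, ‖f x‖ ≤ ‖ξ‖ * ‖η‖ * ‖x‖ := by
  have hb : ∀ t : A ⊗[ℂ] B, ‖⟪ξ, π.tensor ρ t η⟫_ℂ‖ ≤ ‖ξ‖ * ‖η‖ * spatialNorm t := fun t => by
    refine (norm_inner_le_norm ξ (π.tensor ρ t η)).trans ?_
    have := ((π.tensor ρ t).le_opNorm η).trans
      (mul_le_mul_of_nonneg_right (norm_tensor_le π ρ t) (norm_nonneg η))
    calc ‖ξ‖ * ‖π.tensor ρ t η‖ ≤ ‖ξ‖ * (spatialNorm t * ‖η‖) := by gcongr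
      _ = _ := by ring
  let f₀ : A ⊗[ℂ] B →ₗ[ℂ] ℂ :=
    { toFun := fun t => ⟪ξ, π.tensor ρ t η⟫_ℂ
      map_add' := fun s t => by rw [map_add, add_apply, inner_add_right]
      map_smul' := fun c t => by rw [map_smul, smul_apply, inner_smul_right]; rfl }
  let f : StrongDual ℂ (CStarTensor A B) :=
    ContinuousLinearMap.fromCompletion (α := AlgTensor A B)
      (LinearMap.mkContinuous (E := AlgTensor A B) f₀ (‖ξ‖ * ‖η‖) hb)
  have hf : ∀ t, f (toTensor A B t) = ⟪ξ, π.tensor ρ t η⟫_ℂ := fun t =>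
    ContinuousLinearMap.fromCompletion_apply_coe (α := AlgTensor A B) _ t
  refine ⟨f, hf, fun x => ?_⟩
  induction x using tensor_induction with
  | hp => exact isClosed_le (by fun_prop) (by fun_prop)
  | ih t => rw [hf, norm_toTensor]; exact hb t

/-- The functional `b ↦ ⟨x, ρ(b) y⟩` as an element of the dual. -/
def HilbertRep.coeffL (ρ : HilbertRep B) (x y : ρ.H) : StrongDual ℂ B :=
  (ρ.coeff x y).mkContinuous (‖x‖ * ‖y‖) fun b => by
    rw [HilbertRep.coeff_apply]
    refine (norm_inner_le_norm _ _).trans ?_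
    have := ((ρ.rep b).le_opNorm y).trans
      (mul_le_mul_of_nonneg_right (ρ.norm_rep_le b) (norm_nonneg y))
    calc ‖x‖ * ‖ρ.rep b y‖ ≤ ‖x‖ * (‖b‖ * ‖y‖) := by gcongr
      _ = _ := by ring

/-- The slice maps separate the points of the spatial tensor product: slices by vector functionals
of representations recover all coefficients of `π ⊗ ρ`, and these determine the spatial norm. -/
theorem eq_zero_of_slice_eq_zero {x : CStarTensor A B}
    (h : ∀ ω : StrongDual ℂ B, slice A ω x = 0) : x = 0 := by
  have key : ∀ (π : HilbertRep A) (ρ : HilbertRep B) (ξ η : π.H ⊗[ℂ] ρ.H)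
      (f : StrongDual ℂ (CStarTensor A B)),
      (∀ t, f (toTensor A B t) = ⟪ξ, π.tensor ρ t η⟫_ℂ) → f x = 0 := by
    intro π ρ ξ
    induction ξ using TensorProduct.induction_on with
    | zero =>
      intro η f hf
      have : f = 0 := clm_ext_elem fun a b => (hf _).trans (inner_zero_left _)
      rw [this, zero_apply]
    | add ξ ξ' hξ hξ' =>
      intro η f hf
      obtain ⟨g, hg, -⟩ := exists_coeff π ρ ξ η
      obtain ⟨g', hg', -⟩ := exists_coeff π ρ ξ' η
      have : f = g + g' := clm_ext_elem fun a b => by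
        rw [add_apply]
        exact (hf _).trans ((inner_add_left _ _ _).trans
          (congrArg₂ (· + ·) (hg _).symm (hg' _).symm))
      rw [this, add_apply, hξ η g hg, hξ' η g' hg', add_zero]
    | tmul p p' =>
      intro η
      induction η using TensorProduct.induction_on with
      | zero =>
        intro f hf
        have : f = 0 := clm_ext_elem fun a b => (hf _).trans (by simp)
        rw [this, zero_apply]
      | add η η' hη hη' =>
        intro f hf
        obtain ⟨g, hg, -⟩ := exists_coeff π ρ (p ⊗ₜ p') η
        obtain ⟨g', hg', -⟩ := exists_coeff π ρ (p ⊗ₜ p') η'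
        have : f = g + g' := clm_ext_elem fun a b => by
          rw [add_apply]
          refine (hf _).trans ?_
          rw [map_add, inner_add_right]
          exact congrArg₂ (· + ·) (hg _).symm (hg' _).symm
        rw [this, add_apply, hη g hg, hη' g' hg', add_zero]
      | tmul q q' =>
        intro f hf
        have : f = π.coeffL p q ∘L slice A (ρ.coeffL p' q') := clm_ext_elem fun a b => by
          rw [ContinuousLinearMap.comp_apply, slice_elem, map_smul]
          refine (hf _).trans ?_
          rw [HilbertRep.tensor_tmul, TensorProduct.mapL_tmul, TensorProduct.inner_tmul, mul_comm]
          rfl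
        rw [this, ContinuousLinearMap.comp_apply, h, map_zero]
  -- The norm of `z` is determined by coefficients, and those of `z` and `z - x` agree.
  have small : ∀ z : CStarTensor A B, ‖z‖ ≤ ‖z - x‖ := fun z => by
    induction z using tensor_induction with
    | hp => exact isClosed_le (by fun_prop) (by fun_prop)
    | ih t =>
      rw [norm_toTensor]
      refine spatialNorm_le fun π ρ => opNorm_le_of_inner_le _ (norm_nonneg _) fun ξ η => ?_
      obtain ⟨f, hf, hfb⟩ := exists_coeff π ρ ξ η
      have := hfb (toTensor A B t - x)
      rw [map_sub, key π ρ ξ η f hf, sub_zero, hf] at this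
      exact this.trans_eq (by ring)
  simpa using small x

end SliceBasics

/-! ### Tensor products of adjointable operators -/

/-- If `N n` grows at most like `Mⁿ` and `N n ^ 2 ≤ N 0 * N (2 n)`, then `N 1 ≤ M * N 0`:
otherwise iterated squaring makes `N (2 ^ n)` grow faster. -/
theorem le_mul_of_sq_le_mul_of_le_pow {N : ℕ → ℝ} {C M : ℝ} (hM : 0 ≤ M) (hN : ∀ n, 0 ≤ N n)
    (hsq : ∀ n, N n ^ 2 ≤ N 0 * N (2 * n)) (hC : ∀ n, N n ≤ C * M ^ n) : N 1 ≤ M * N 0 := by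
  by_contra! hlt
  have h0 : 0 < N 0 := by
    refine (hN 0).lt_of_ne fun h => ?_
    have := hsq 1
    rw [← h] at this hlt
    nlinarith
  have hC0 : 0 ≤ C := by simpa using (hN 0).trans (hC 0)
  -- Comparing with `L > M` instead of `M` allows for `M = 0`.
  obtain ⟨L, hML, hLq⟩ := exists_between ((lt_div_iff₀ h0).2 hlt)
  have hL : 0 < L := hM.trans_lt hML
  set q := N 1 / N 0 with hq
  have hq0 : 0 < q := hL.trans hLq
  have grow : ∀ n, q ^ 2 ^ n * N 0 ≤ N (2 ^ n) := fun n => by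
    induction n with
    | zero => simp [hq, h0.ne']
    | succ n ih =>
      have h1 := hsq (2 ^ n)
      rw [← pow_succ'] at h1
      have h2 : (q ^ 2 ^ n * N 0) ^ 2 ≤ N (2 ^ n) ^ 2 := by gcongr
      refine le_of_mul_le_mul_left ?_ h0
      calc N 0 * (q ^ 2 ^ (n + 1) * N 0) = (q ^ 2 ^ n * N 0) ^ 2 := by ring
        _ ≤ _ := h2.trans h1
  obtain ⟨n, hn⟩ := pow_unbounded_of_one_lt (C / N 0) ((one_lt_div hL).2 hLq)
  have h1 : (q / L) ^ n ≤ (q / L) ^ 2 ^ n :=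
    pow_le_pow_right₀ ((one_lt_div hL).2 hLq).le Nat.lt_two_pow_self.le
  have h2 : q ^ 2 ^ n * N 0 ≤ C * L ^ 2 ^ n :=
    (grow n).trans ((hC _).trans (by gcongr))
  have h3 := hn.trans_le h1
  rw [div_pow, div_lt_div_iff₀ h0 (by positivity)] at h3
  linarith

section

variable {X Y : Type*} [NormedAddCommGroup X] [NormedSpace ℂ X] [NormedAddCommGroup Y]
  [NormedSpace ℂ Y]

/-- The algebraic tensor product of two operators. -/
def opT (S : X →L[ℂ] X) (T : Y →L[ℂ] Y) : X ⊗[ℂ] Y →ₗ[ℂ] X ⊗[ℂ] Y :=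
  TensorProduct.map S.toLinearMap T.toLinearMap

@[simp]
theorem opT_tmul (S : X →L[ℂ] X) (T : Y →L[ℂ] Y) (x : X) (y : Y) :
    opT S T (x ⊗ₜ y) = S x ⊗ₜ T y := rfl

end

section TensorOperators

open HilbertModule Correspondence

variable {A X : Type u} {B Y : Type v} [NonUnitalCStarAlgebra A] [NonUnitalCStarAlgebra B]
  [NormedAddCommGroup X] [NormedSpace ℂ X] [CompleteSpace X]
  [NormedAddCommGroup Y] [NormedSpace ℂ Y] [CompleteSpace Y]
  [Correspondence A X] [Correspondence B Y]

variable (A B) in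
theorem ipT_opT {S S' : X →L[ℂ] X} {T T' : Y →L[ℂ] Y}
    (hS : ∀ x y, (ip (S x) y : A) = ip x (S' y)) (hT : ∀ x y, (ip (T x) y : B) = ip x (T' y))
    (z w : X ⊗[ℂ] Y) : ipT A X B Y (opT S T z) w = ipT A X B Y z (opT S' T' w) := by
  induction z using TensorProduct.induction_on with
  | zero => simp
  | add z z' h h' => simp only [map_add, LinearMap.add_apply, h, h']
  | tmul x y =>
    induction w using TensorProduct.induction_on with
    | zero => simp
    | add w w' h h' => simp only [map_add, h, h']
    | tmul x' y' => rw [opT_tmul, opT_tmul, ipT_tmul, ipT_tmul, hS, hT]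

theorem extNorm_add_le (z w : X ⊗[ℂ] Y) :
    extNorm A B (z + w) ≤ extNorm A B z + extNorm A B w :=
  map_add_le_add (extSeminorm A X B Y) z w

theorem extNorm_tmul_le (x : X) (y : Y) : extNorm A B (x ⊗ₜ[ℂ] y) ≤ ‖x‖ * ‖y‖ := by
  refine Real.sqrt_le_iff.2 ⟨by positivity, ?_⟩
  rw [ipT_tmul, mul_pow, norm_sq (A := A) x, norm_sq (A := B) y]
  exact spatialNorm_tmul_le _ _

variable (A B) in
/-- A crude bound for `(S ⊗ T) z`, with a constant depending on a representation of `z` as a sum of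
elementary tensors; `extNorm_opT_le` improves it to the norm of `z`. -/
theorem exists_extNorm_opT_le (z : X ⊗[ℂ] Y) : ∃ C : ℝ,
    ∀ (S : X →L[ℂ] X) (T : Y →L[ℂ] Y), extNorm A B (opT S T z) ≤ C * (‖S‖ * ‖T‖) := by
  induction z using TensorProduct.induction_on with
  | zero =>
    refine ⟨0, fun S T => ?_⟩
    rw [map_zero, zero_mul]
    exact (map_zero (extSeminorm A X B Y)).le
  | add z w hz hw =>
    obtain ⟨C, hC⟩ := hz
    obtain ⟨D, hD⟩ := hw
    refine ⟨C + D, fun S T => ?_⟩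
    rw [map_add, add_mul]
    exact (extNorm_add_le _ _).trans (add_le_add (hC S T) (hD S T))
  | tmul x y =>
    refine ⟨‖x‖ * ‖y‖, fun S T => (extNorm_tmul_le (S x) (T y)).trans ?_⟩
    calc ‖S x‖ * ‖T y‖ ≤ (‖S‖ * ‖x‖) * (‖T‖ * ‖y‖) := by
          gcongr
          exacts [S.le_opNorm x, T.le_opNorm y]
      _ = _ := by ring

variable (A) in
theorem ip_pow {P : X →L[ℂ] X} (hP : ∀ x y, (ip (P x) y : A) = ip x (P y)) (n : ℕ) :
    ∀ x y, (ip ((P ^ n) x) y : A) = ip x ((P ^ n) y) := by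
  induction n with
  | zero => simp
  | succ n ih =>
    intro x y
    rw [pow_succ, mul_apply_eq_comp, ih, hP, ← mul_apply_eq_comp, ← pow_succ', pow_succ]

/-- The bound `‖S ⊗ T‖ ≤ ‖S‖ ‖T‖` for adjointable operators. With `P = S⋆ S` and `Q = T⋆ T`, the
numbers `‖(P ⊗ Q)ⁿ z‖` satisfy the hypotheses of `le_mul_of_sq_le_mul_of_le_pow`. -/
theorem extNorm_opT_le {S S' : X →L[ℂ] X} {T T' : Y →L[ℂ] Y}
    (hS : ∀ x y, (ip (S x) y : A) = ip x (S' y)) (hT : ∀ x y, (ip (T x) y : B) = ip x (T' y))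
    (z : X ⊗[ℂ] Y) : extNorm A B (opT S T z) ≤ ‖S‖ * ‖T‖ * extNorm A B z := by
  set P := S' * S with hP_def
  set Q := T' * T with hQ_def
  have hS' : ∀ x y, (ip (S' x) y : A) = ip x (S y) := fun x y => by
    rw [← star_ip, ← hS, star_ip]
  have hT' : ∀ x y, (ip (T' x) y : B) = ip x (T y) := fun x y => by
    rw [← star_ip, ← hT, star_ip]
  have hP : ∀ x y, (ip (P x) y : A) = ip x (P y) := fun x y => by
    rw [hP_def, mul_apply_eq_comp, mul_apply_eq_comp, hS', hS]
  have hQ : ∀ x y, (ip (Q x) y : B) = ip x (Q y) := fun x y => by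
    rw [hQ_def, mul_apply_eq_comp, mul_apply_eq_comp, hT', hT]
  let N : ℕ → ℝ := fun n => extNorm A B (opT (P ^ n) (Q ^ n) z)
  have hN0 : N 0 = extNorm A B z := by
    change extNorm A B (opT (P ^ 0) (Q ^ 0) z) = _
    congr 1
    rw [pow_zero, pow_zero]
    exact LinearMap.congr_fun TensorProduct.map_id z
  have hcomp : ∀ n, opT (P ^ n) (Q ^ n) (opT (P ^ n) (Q ^ n) z)
      = opT (P ^ (2 * n)) (Q ^ (2 * n)) z := fun n => by
    rw [two_mul, pow_add, pow_add]
    exact (LinearMap.congr_fun (TensorProduct.map_comp _ _ _ _) z).symm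
  have hsq : ∀ n, N n ^ 2 ≤ N 0 * N (2 * n) := fun n => by
    rw [extNorm_sq, ipT_opT A B (ip_pow A hP n) (ip_pow B hQ n), hcomp, hN0]
    exact spatialNorm_ipT_le _ _
  obtain ⟨C, hC⟩ := exists_extNorm_opT_le A B z
  -- The summand `N 0` takes care of `n = 0`.
  have hCN : ∀ n, N n ≤ (|C| + N 0) * (‖P‖ * ‖Q‖) ^ n := fun n => by
    rcases Nat.eq_zero_or_pos n with rfl | hn
    · simp
    · calc N n ≤ C * (‖P ^ n‖ * ‖Q ^ n‖) := hC _ _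
        _ ≤ (|C| + N 0) * (‖P‖ ^ n * ‖Q‖ ^ n) := by
          gcongr
          · exact add_nonneg (abs_nonneg C) (extNorm_nonneg _)
          · exact (le_abs_self C).trans (le_add_of_nonneg_right (extNorm_nonneg _))
          · exact norm_pow_le' P hn
          · exact norm_pow_le' Q hn
        _ = _ := by rw [mul_pow]
  have h1 : N 1 ≤ ‖P‖ * ‖Q‖ * N 0 :=
    le_mul_of_sq_le_mul_of_le_pow (by positivity) (fun n => extNorm_nonneg _) hsq hCN
  have hP1 : ‖P‖ ≤ ‖S‖ * ‖S‖ := (norm_mul_le _ _).trans (by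
    gcongr; exact norm_le_of_adjoint hS)
  have hQ1 : ‖Q‖ ≤ ‖T‖ * ‖T‖ := (norm_mul_le _ _).trans (by
    gcongr; exact norm_le_of_adjoint hT)
  refine le_of_sq_le_sq ?_ (mul_nonneg (by positivity) (extNorm_nonneg z))
  have hz : opT S' T' (opT S T z) = opT (P ^ 1) (Q ^ 1) z := by
    rw [pow_one, pow_one]
    exact (LinearMap.congr_fun (TensorProduct.map_comp _ _ _ _) z).symm
  rw [hN0] at h1
  calc extNorm A B (opT S T z) ^ 2 ≤ extNorm A B z * N 1 := by
        rw [extNorm_sq, ipT_opT A B hS hT, hz]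
        exact spatialNorm_ipT_le _ _
    _ ≤ extNorm A B z * (‖P‖ * ‖Q‖ * extNorm A B z) :=
        mul_le_mul_of_nonneg_left h1 (extNorm_nonneg z)
    _ ≤ extNorm A B z * ((‖S‖ * ‖S‖) * (‖T‖ * ‖T‖) * extNorm A B z) := by
        have := extNorm_nonneg (A := A) (B := B) z
        gcongr
    _ = _ := by ring

/-- The operator `S ⊗ T` on the external tensor product, for adjointable `S` and `T`. -/
theorem exists_tensor_op {S S' : X →L[ℂ] X} {T T' : Y →L[ℂ] Y}
    (hS : ∀ x y, (ip (S x) y : A) = ip x (S' y)) (hT : ∀ x y, (ip (T x) y : B) = ip x (T' y)) :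
    ∃ R : ExtTensor A X B Y →L[ℂ] ExtTensor A X B Y,
      (∀ z, R (toExt A X B Y z) = toExt A X B Y (opT S T z)) ∧ ‖R‖ ≤ ‖S‖ * ‖T‖ :=
  ⟨ContinuousLinearMap.completion (α := AlgExt A X B Y) (β := AlgExt A X B Y)
      (LinearMap.mkContinuous (E := AlgExt A X B Y) (F := AlgExt A X B Y) (opT S T) (‖S‖ * ‖T‖)
        (extNorm_opT_le hS hT)),
    fun z => ContinuousLinearMap.completion_apply_coe (α := AlgExt A X B Y)
      (β := AlgExt A X B Y) _ z,
    norm_completion_le (F := AlgExt A X B Y) (G := AlgExt A X B Y) _ (by positivity)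
      (extNorm_opT_le hS hT)⟩

theorem clm_ext_tmul {E : Type*} [NormedAddCommGroup E] [NormedSpace ℂ E]
    {f g : ExtTensor A X B Y →L[ℂ] E}
    (h : ∀ x y, f (toExt A X B Y (x ⊗ₜ y)) = g (toExt A X B Y (x ⊗ₜ y))) : f = g := by
  ext z
  induction z using ext_induction with
  | hp => exact isClosed_eq f.continuous g.continuous
  | ih t =>
    induction t using TensorProduct.induction_on with
    | zero => simp
    | tmul x y => exact h x y
    | add s t hs ht => rw [map_add, map_add, map_add, hs, ht]

theorem φ_elem_toExt (a : A) (b : B) (x : X) (y : Y) :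
    φ (elem a b : CStarTensor A B) (toExt A X B Y (x ⊗ₜ y))
      = toExt A X B Y ((φ a x : X) ⊗ₜ (φ b y : Y)) :=
  leftE_coe A X B Y (a ⊗ₜ b) (x ⊗ₜ y)

theorem ip_toExt (x x' : X) (y y' : Y) :
    (ip (toExt A X B Y (x ⊗ₜ y)) (toExt A X B Y (x' ⊗ₜ y')) : CStarTensor A B)
      = elem (ip x x') (ip y y') :=
  ipE_coe A X B Y (x ⊗ₜ y) (x' ⊗ₜ y')

theorem act_elem_toExt (a : A) (b : B) (x : X) (y : Y) :
    act (elem a b : CStarTensor A B) (toExt A X B Y (x ⊗ₜ y))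
      = toExt A X B Y ((act a x : X) ⊗ₜ (act b y : Y)) :=
  actE_coe A X B Y (a ⊗ₜ b) (x ⊗ₜ y)

theorem rankOne_toExt (x x' z : X) (y y' w : Y) :
    rankOne (CStarTensor A B) (ExtTensor A X B Y) (toExt A X B Y (x ⊗ₜ y))
        (toExt A X B Y (x' ⊗ₜ y')) (toExt A X B Y (z ⊗ₜ w))
      = toExt A X B Y (rankOne A X x x' z ⊗ₜ rankOne B Y y y' w) := by
  rw [rankOne_apply, ip_toExt, act_elem_toExt, rankOne_apply, rankOne_apply]

/-- Approximating `φ a` by finite-rank operators `F` approximates `φ (a ⊗ b)` by the finite-rank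
operators `F ⊗ φ b`. -/
theorem φ_elem_mem_compacts {a : A} (ha : (φ a : X →L[ℂ] X) ∈ compacts A X) {b : B} {y y' : Y}
    (hb : φ b = rankOne B Y y y') :
    (φ (elem a b : CStarTensor A B) : ExtTensor A X B Y →L[ℂ] ExtTensor A X B Y)
      ∈ compacts (CStarTensor A B) (ExtTensor A X B Y) := by
  have fin : ∀ F ∈ Submodule.span ℂ {T : X →L[ℂ] X | ∃ x x' : X, T = rankOne A X x x'},
      (∃ F' : X →L[ℂ] X, ∀ x x', (ip (F x) x' : A) = ip x (F' x')) ∧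
      ∃ R ∈ compacts (CStarTensor A B) (ExtTensor A X B Y), ∀ x w,
        R (toExt A X B Y (x ⊗ₜ w)) = toExt A X B Y (F x ⊗ₜ φ b w) := by
    intro F hF
    induction hF using Submodule.span_induction with
    | mem F hF =>
      obtain ⟨x, x', rfl⟩ := hF
      refine ⟨⟨_, rankOne_adjoint x x'⟩, _, rankOne_mem_compacts (toExt A X B Y (x ⊗ₜ y))
        (toExt A X B Y (x' ⊗ₜ y')), fun z w => ?_⟩
      rw [rankOne_toExt, hb]
    | zero =>
      exact ⟨⟨0, fun x x' => by simp⟩, 0, zero_mem _, fun x w => by simp⟩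
    | add F G _ _ hF hG =>
      obtain ⟨⟨F', hF'⟩, R, hR, hRF⟩ := hF
      obtain ⟨⟨G', hG'⟩, Q, hQ, hQG⟩ := hG
      refine ⟨⟨F' + G', fun x x' => ?_⟩, R + Q, add_mem hR hQ, fun x w => ?_⟩
      · simp only [add_apply, map_add, LinearMap.add_apply, hF', hG']
      · rw [add_apply, add_apply, hRF, hQG, TensorProduct.add_tmul, map_add]
    | smul c F _ hF =>
      obtain ⟨⟨F', hF'⟩, R, hR, hRF⟩ := hF
      refine ⟨⟨conj c • F', fun x x' => ?_⟩, c • R, Submodule.smul_mem _ c hR, fun x w => ?_⟩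
      · simp only [smul_apply, map_smulₛₗ, LinearMap.smul_apply, hF', RingHom.id_apply]
      · rw [smul_apply, smul_apply, hRF, ← TensorProduct.smul_tmul', map_smul]
  rw [← SetLike.mem_coe, ← isClosed_compacts.closure_eq, Metric.mem_closure_iff]
  intro ε hε
  rw [compacts_eq, ← SetLike.mem_coe, Submodule.topologicalClosure_coe,
    Metric.mem_closure_iff] at ha
  obtain ⟨F, hF, hd⟩ := ha (ε / (‖b‖ + 1)) (by positivity)
  obtain ⟨⟨F', hF'⟩, R, hR, hRF⟩ := fin F hF
  refine ⟨R, hR, ?_⟩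
  obtain ⟨D, hD, hDn⟩ := exists_tensor_op (A := A) (B := B) (S := φ a - F)
    (S' := φ (star a) - F') (T := (φ b : Y →L[ℂ] Y)) (T' := φ (star b))
    (fun x x' => by
      simp only [sub_apply, map_sub, LinearMap.sub_apply, hF', ip_φ])
    (fun w w' => ip_φ b w w')
  have : (φ (elem a b : CStarTensor A B) : ExtTensor A X B Y →L[ℂ] ExtTensor A X B Y) - R = D :=
    clm_ext_tmul fun x w => by
      rw [hD, sub_apply, hRF, φ_elem_toExt, ← map_sub, ← TensorProduct.sub_tmul, opT_tmul,
        sub_apply]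
  rw [dist_eq_norm, this]
  rw [dist_eq_norm] at hd
  calc ‖D‖ ≤ ‖φ a - F‖ * ‖(φ b : Y →L[ℂ] Y)‖ := hDn
    _ ≤ ‖φ a - F‖ * (‖b‖ + 1) := by
      gcongr
      exact (norm_φ_le b).trans (by linarith)
    _ < ε := (lt_div_iff₀ (by positivity)).1 hd

end TensorOperators

open Filter Topology

/-! ### Imprimitivity bimodules -/

section Imprimitivity

open HilbertModule Correspondence

variable {B Y : Type*} [NonUnitalCStarAlgebra B] [NormedAddCommGroup Y] [NormedSpace ℂ Y]
  [CompleteSpace Y] [Correspondence B Y] {l : Y →ₗ[ℂ] Y →ₗ⋆[ℂ] B}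

namespace IsLeftInnerProduct

theorem φ_left (hl : IsLeftInnerProduct l) (x y : Y) : φ (l x y) = rankOne B Y x y :=
  ContinuousLinearMap.ext fun z => hl.compatible x y z

theorem eq_zero_of_φ_eq_zero (hl : IsLeftInnerProduct l) {b : B} (hb : (φ b : Y →L[ℂ] Y) = 0) :
    b = 0 := by
  have h : ∀ c : B, b * c = 0 := fun c => by
    have : (Submodule.span ℂ {b : B | ∃ x y : Y, b = l x y}).topologicalClosure
        ≤ LinearMap.ker (LinearMap.mulLeft ℂ b) := by
      refine Submodule.topologicalClosure_minimal _ (Submodule.span_le.2 ?_)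
        (isClosed_eq (continuous_const.mul continuous_id) continuous_const)
      rintro _ ⟨x, y, rfl⟩
      change b * l x y = 0
      rw [← hl.left_mul, hb, zero_apply, map_zero, LinearMap.zero_apply]
    rw [hl.left_full] at this
    exact this (Submodule.mem_top (x := c))
  exact (CStarRing.mul_star_self_eq_zero_iff b).1 (h (star b))

/-- For fixed `v`, the map `y ↦ l(y, v)` is continuous. This follows from the closed graph theorem,
since `φ (l(y, v))` is the rank-one operator of `y` and `v` and `φ` is injective. -/
theorem continuous_left (hl : IsLeftInnerProduct l) (v : Y) : Continuous fun y => l y v := by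
  refine (l.flip v).continuous_of_seq_closed_graph fun w y b hw hb => ?_
  have h1 : Tendsto (fun n => φL B Y (l (w n) v)) atTop (𝓝 (φL B Y b)) :=
    ((φL B Y).continuous.tendsto b).comp hb
  have h2 : Tendsto (fun n => φL B Y (l (w n) v)) atTop (𝓝 (φL B Y (l y v))) := by
    simp only [φL_apply, hl.φ_left]
    exact ((((rankOne B Y).flip v).continuous.tendsto y).comp hw)
  have h3 : φL B Y (b - l y v) = 0 := by
    rw [map_sub, tendsto_nhds_unique h1 h2, sub_self]
  exact sub_eq_zero.1 (hl.eq_zero_of_φ_eq_zero h3)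

theorem left_mul_mul_left (hl : IsLeftInnerProduct l) (y z u v : Y) (b : B) :
    l y z * (b * l u v) = l (act (ip z (φ b u) : B) y) v := by
  rw [← hl.left_mul, ← hl.left_mul, hl.compatible]

theorem katsuraIdeal_eq_top (hl : IsLeftInnerProduct l) : katsuraIdeal B Y = ⊤ := by
  refine eq_top_iff.2 fun b _ => ⟨?_, fun c hc => by rw [hl.eq_zero_of_φ_eq_zero hc, mul_zero]⟩
  have : (Submodule.span ℂ {b : B | ∃ x y : Y, b = l x y}).topologicalClosure
      ≤ (compacts B Y).comap (φL B Y).toLinearMap := by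
    refine Submodule.topologicalClosure_minimal _ (Submodule.span_le.2 ?_)
      (isClosed_compacts.preimage (φL B Y).continuous)
    rintro _ ⟨x, y, rfl⟩
    change φ (l x y) ∈ compacts B Y
    rw [hl.φ_left]
    exact rankOne_mem_compacts x y
  rw [hl.left_full] at this
  exact this (Submodule.mem_top (x := b))

end IsLeftInnerProduct

end Imprimitivity

/-! ### Slices of operators on the external tensor product -/

section Ext

open HilbertModule Correspondence

variable {A X : Type u} {B Y : Type v} [NonUnitalCStarAlgebra A] [NonUnitalCStarAlgebra B]
  [NormedAddCommGroup X] [NormedSpace ℂ X] [CompleteSpace X]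
  [NormedAddCommGroup Y] [NormedSpace ℂ Y] [CompleteSpace Y]
  [Correspondence A X] [Correspondence B Y]

variable (A X B Y) in
/-- The rank-one operators of elementary tensors span a dense subspace of the compact operators on
the external tensor product. -/
theorem compacts_ext_le : compacts (CStarTensor A B) (ExtTensor A X B Y) ≤
    (Submodule.span ℂ {T | ∃ (x x' : X) (y y' : Y), T = rankOne (CStarTensor A B)
      (ExtTensor A X B Y) (toExt A X B Y (x ⊗ₜ y)) (toExt A X B Y (x' ⊗ₜ y'))}).topologicalClosure
    := by
  set M := (Submodule.span ℂ {T | ∃ (x x' : X) (y y' : Y), T = rankOne (CStarTensor A B)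
    (ExtTensor A X B Y) (toExt A X B Y (x ⊗ₜ y)) (toExt A X B Y (x' ⊗ₜ y'))}).topologicalClosure
    with hMdef
  have hM : IsClosed (M : Set (ExtTensor A X B Y →L[ℂ] ExtTensor A X B Y)) :=
    Submodule.isClosed_topologicalClosure _
  refine compacts_le hM fun ξ η => ?_
  induction ξ using ext_induction with
  | hp => exact hM.preimage ((rankOne (CStarTensor A B) (ExtTensor A X B Y)).flip η).continuous
  | ih s =>
    induction η using ext_induction with
    | hp => exact hM.preimage (rankOne (CStarTensor A B) (ExtTensor A X B Y) _).continuous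
    | ih t =>
      induction s using TensorProduct.induction_on with
      | zero => rw [map_zero, map_zero, zero_apply]; exact zero_mem M
      | add s s' hs hs' => rw [map_add, map_add, add_apply]; exact add_mem hs hs'
      | tmul x y =>
        induction t using TensorProduct.induction_on with
        | zero => rw [map_zero, map_zero]; exact zero_mem M
        | add t t' ht ht' => rw [map_add, map_add]; exact add_mem ht ht'
        | tmul x' y' =>
          exact Submodule.le_topologicalClosure _ (Submodule.subset_span ⟨x, x', y, y', rfl⟩)

theorem slice_rankOne_toExt (ψ : StrongDual ℂ B) (z u y y' : Y) (x x' p p' : X) :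
    slice A ψ (ip (toExt A X B Y (x ⊗ₜ z)) (rankOne (CStarTensor A B) (ExtTensor A X B Y)
      (toExt A X B Y (p ⊗ₜ y)) (toExt A X B Y (p' ⊗ₜ y')) (toExt A X B Y (x' ⊗ₜ u))))
      = ip x ((ψ (ip z (rankOne B Y y y' u)) • rankOne A X p p') x') := by
  rw [rankOne_toExt, ip_toExt, slice_elem, smul_apply, map_smul]

theorem norm_slice_le (ω : StrongDual ℂ B) (x : CStarTensor A B) :
    ‖slice A ω x‖ ≤ ‖ω‖ * ‖x‖ := by
  induction x using tensor_induction with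
  | hp => exact isClosed_le (by fun_prop) (by fun_prop)
  | ih t => rw [slice_coe, norm_toTensor]; exact norm_sliceT_le ω t

/-- Compressing a compact operator on `X ⊗ Y` by vectors `z`, `u` of `Y` and slicing with a
functional `ψ` gives a compact operator on `X`. -/
theorem mem_compacts_of_slice {T : ExtTensor A X B Y →L[ℂ] ExtTensor A X B Y}
    (hT : T ∈ compacts (CStarTensor A B) (ExtTensor A X B Y)) (ψ : StrongDual ℂ B) (z u : Y)
    {S : X →L[ℂ] X} (hS : ∀ x x', (ip x (S x') : A)
      = slice A ψ (ip (toExt A X B Y (x ⊗ₜ z)) (T (toExt A X B Y (x' ⊗ₜ u))))) :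
    S ∈ compacts A X := by
  have fin : ∀ F ∈ Submodule.span ℂ {T | ∃ (x x' : X) (y y' : Y), T = rankOne (CStarTensor A B)
      (ExtTensor A X B Y) (toExt A X B Y (x ⊗ₜ y)) (toExt A X B Y (x' ⊗ₜ y'))},
      ∃ G ∈ compacts A X, ∀ x x', (ip x (G x') : A)
        = slice A ψ (ip (toExt A X B Y (x ⊗ₜ z)) (F (toExt A X B Y (x' ⊗ₜ u)))) := by
    intro F hF
    induction hF using Submodule.span_induction with
    | mem F hF =>
      obtain ⟨p, p', y, y', rfl⟩ := hF
      exact ⟨_, Submodule.smul_mem _ _ (rankOne_mem_compacts p p'),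
        fun x x' => (slice_rankOne_toExt ψ z u y y' x x' p p').symm⟩
    | zero => exact ⟨0, zero_mem _, fun x x' => by simp⟩
    | add F F' _ _ hF hF' =>
      obtain ⟨G, hG, h⟩ := hF
      obtain ⟨G', hG', h'⟩ := hF'
      refine ⟨G + G', add_mem hG hG', fun x x' => ?_⟩
      simp only [add_apply, map_add, h, h']
    | smul c F _ hF =>
      obtain ⟨G, hG, h⟩ := hF
      refine ⟨c • G, Submodule.smul_mem _ c hG, fun x x' => ?_⟩
      simp only [smul_apply, map_smul, h]
  rw [← SetLike.mem_coe, ← isClosed_compacts.closure_eq, Metric.mem_closure_iff]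
  intro ε hε
  have hT' := compacts_ext_le A X B Y hT
  rw [← SetLike.mem_coe, Submodule.topologicalClosure_coe, Metric.mem_closure_iff] at hT'
  set K : ℝ := ‖ψ‖ * ‖z‖ * ‖u‖ with hK
  have hK0 : 0 ≤ K := by positivity
  obtain ⟨F, hF, hd⟩ := hT' (ε / (K + 1)) (by positivity)
  obtain ⟨G, hG, h⟩ := fin F hF
  refine ⟨G, hG, ?_⟩
  rw [dist_eq_norm] at hd ⊢
  have hle : ‖S - G‖ ≤ K * ‖T - F‖ := by
    refine opNorm_le_of_ip_le (A := A) (by positivity) fun x x' => ?_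
    have e : (ip x ((S - G) x') : A)
        = slice A ψ (ip (toExt A X B Y (x ⊗ₜ z)) ((T - F) (toExt A X B Y (x' ⊗ₜ u)))) := by
      simp only [sub_apply, map_sub, hS, h]
    have n1 : ‖toExt A X B Y (x ⊗ₜ z)‖ ≤ ‖x‖ * ‖z‖ :=
      (norm_toExt A X B Y _).trans_le (extNorm_tmul_le x z)
    have n2 : ‖toExt A X B Y (x' ⊗ₜ u)‖ ≤ ‖x'‖ * ‖u‖ :=
      (norm_toExt A X B Y _).trans_le (extNorm_tmul_le x' u)
    rw [e]
    calc _ ≤ ‖ψ‖ * (‖toExt A X B Y (x ⊗ₜ z)‖ * (‖T - F‖ * ‖toExt A X B Y (x' ⊗ₜ u)‖)) := by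
          refine (norm_slice_le _ _).trans ?_
          gcongr
          refine (norm_ip_le _ _ _).trans ?_
          gcongr
          exact (T - F).le_opNorm _
      _ ≤ ‖ψ‖ * ((‖x‖ * ‖z‖) * (‖T - F‖ * (‖x'‖ * ‖u‖))) := by gcongr
      _ = _ := by rw [hK]; ring
  calc ‖S - G‖ ≤ K * ‖T - F‖ := hle
    _ ≤ ‖T - F‖ * (K + 1) := by nlinarith [norm_nonneg (T - F)]
    _ < ε := (lt_div_iff₀ (by positivity)).1 hd

variable {l : Y →ₗ[ℂ] Y →ₗ⋆[ℂ] B}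

/-- For an imprimitivity bimodule `Y`, the functional `b ↦ ω(l(y, z) b l(u, v))` has the form
`b ↦ ψ(⟨z, φ(b) u⟩)`. Hence the slice of `w` by it acts on `X` by the compression of `φ w`. -/
theorem exists_ip_φ_slice (hl : IsLeftInnerProduct l) (ω : StrongDual ℂ B) (y z u v : Y) :
    ∃ ψ : StrongDual ℂ B, ∀ (w : CStarTensor A B) (x x' : X),
      (ip x (φ (slice A ((ω ∘L ContinuousLinearMap.mul ℂ B (l y z)) ∘L
        (ContinuousLinearMap.mul ℂ B).flip (l u v)) w) x') : A)
      = slice A ψ (ip (toExt A X B Y (x ⊗ₜ z)) (φ w (toExt A X B Y (x' ⊗ₜ u)))) := by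
  let lv : Y →L[ℂ] B := ⟨l.flip v, hl.continuous_left v⟩
  refine ⟨ω ∘L lv ∘L (actL B Y).flip y, fun w x x' => ?_⟩
  have : ipL A X x ∘L (φL A X).flip x' ∘L slice A ((ω ∘L ContinuousLinearMap.mul ℂ B (l y z)) ∘L
        (ContinuousLinearMap.mul ℂ B).flip (l u v))
      = slice A (ω ∘L lv ∘L (actL B Y).flip y) ∘L
        ipL (CStarTensor A B) (ExtTensor A X B Y) (toExt A X B Y (x ⊗ₜ z)) ∘L
        (φL (CStarTensor A B) (ExtTensor A X B Y)).flip (toExt A X B Y (x' ⊗ₜ u)) :=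
    clm_ext_elem fun a b => by
      simp only [ContinuousLinearMap.comp_apply, ContinuousLinearMap.flip_apply, ipL_apply,
        φL_apply, slice_elem, φ_elem_toExt, ip_toExt, map_smul,
        ContinuousLinearMap.mul_apply', hl.left_mul_mul_left, actL_apply]
      rfl
  exact DFunLike.congr_fun this w

end Ext

/-! ### The Katsura ideal of the external tensor product -/

section Katsura

open HilbertModule Correspondence

/-- By an approximate unit, `x` is a limit of elements `u x v`. -/
theorem mem_of_mul_mul_mem {D : Type*} [NonUnitalCStarAlgebra D] {S : Set D} (hS : IsClosed S)
    {x : D} (h : ∀ u v : D, u * (x * v) ∈ S) : x ∈ S := by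
  let _ : PartialOrder D := CStarAlgebra.spectralOrder D
  have _ : StarOrderedRing D := CStarAlgebra.spectralOrderedRing D
  have hD := (CStarAlgebra.increasingApproximateUnit (A := D)).toIsApproximateUnit
  have := hD.neBot
  have h1 : ∀ u : D, u * x ∈ S := fun u =>
    hS.mem_of_tendsto ((hD.tendsto_mul_left x).const_mul u) (Eventually.of_forall fun v => h u v)
  exact hS.mem_of_tendsto (hD.tendsto_mul_right x) (Eventually.of_forall h1)

variable {A X : Type u} {B Y : Type v} [NonUnitalCStarAlgebra A] [NonUnitalCStarAlgebra B]
  [NormedAddCommGroup X] [NormedSpace ℂ X] [CompleteSpace X]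
  [NormedAddCommGroup Y] [NormedSpace ℂ Y] [CompleteSpace Y]
  [Correspondence A X] [Correspondence B Y] {l : Y →ₗ[ℂ] Y →ₗ⋆[ℂ] B}

theorem φ_elem_eq_zero {a : A} (ha : (φ a : X →L[ℂ] X) = 0) (b : B) :
    (φ (elem a b : CStarTensor A B) : ExtTensor A X B Y →L[ℂ] ExtTensor A X B Y) = 0 :=
  clm_ext_tmul fun x y => by
    rw [φ_elem_toExt, ha, zero_apply, zero_apply, TensorProduct.zero_tmul, map_zero]

/-- Slices of elements of the Katsura ideal of `X ⊗ Y` lie in the Katsura ideal of `X`. For the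
slices by `b ↦ ω(l(y, z) b l(u, v))` this is `mem_compacts_of_slice`; general slices are limits
of these by fullness and an approximate unit. -/
theorem slice_mem_katsuraIdeal (hl : IsLeftInnerProduct l) {x : CStarTensor A B}
    (hx : x ∈ katsuraIdeal (CStarTensor A B) (ExtTensor A X B Y)) (ω : StrongDual ℂ B) :
    slice A ω x ∈ katsuraIdeal A X := by
  have base : ∀ y z u v : Y, slice A ((ω ∘L ContinuousLinearMap.mul ℂ B (l y z)) ∘L
      (ContinuousLinearMap.mul ℂ B).flip (l u v)) x ∈ katsuraIdeal A X := by
    refine fun y z u v => ⟨?_, fun k hk => ?_⟩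
    · obtain ⟨ψ, hψ⟩ := exists_ip_φ_slice (A := A) (X := X) hl ω y z u v
      exact mem_compacts_of_slice hx.1 ψ z u (hψ x)
    · rw [← slice_mul_elem, hx.2 _ (φ_elem_eq_zero hk _), map_zero]
  refine mem_of_mul_mul_mem (S := slice A ω ⁻¹' katsuraIdeal A X)
    (isClosed_katsuraIdeal.preimage (slice A ω).continuous) fun s t => ?_
  have hcl : ∀ r, IsClosed (((katsuraIdeal A X).comap
      ((slice A ω).toLinearMap ∘ₗ LinearMap.mulRight ℂ r) :
        Submodule ℂ (CStarTensor A B)) : Set (CStarTensor A B)) := fun r =>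
    isClosed_katsuraIdeal.preimage
      ((slice A ω).continuous.comp (continuous_id.mul continuous_const))
  have hcl' : ∀ r, IsClosed (((katsuraIdeal A X).comap
      ((slice A ω).toLinearMap ∘ₗ LinearMap.mulLeft ℂ r ∘ₗ LinearMap.mulLeft ℂ x) :
        Submodule ℂ (CStarTensor A B)) : Set (CStarTensor A B)) := fun r =>
    isClosed_katsuraIdeal.preimage ((slice A ω).continuous.comp
      (continuous_const.mul (continuous_const.mul continuous_id)))
  refine mem_of_elem_mem (hcl (x * t)) (fun a b => ?_) s
  refine elem_mem_of_dense (hcl (x * t)) hl.left_full ?_ b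
  rintro _ ⟨y, z, rfl⟩
  refine mem_of_elem_mem (hcl' (elem a (l y z))) (fun c d => ?_) t
  refine elem_mem_of_dense (hcl' (elem a (l y z))) hl.left_full ?_ d
  rintro _ ⟨u, v, rfl⟩
  change slice A ω (elem a (l y z) * (x * elem c (l u v))) ∈ katsuraIdeal A X
  rw [slice_elem_mul, slice_mul_elem]
  exact mul_mem_katsuraIdeal_left a (mul_mem_katsuraIdeal_right c (base y z u v))

theorem elem_mem_katsuraIdeal (hl : IsLeftInnerProduct l) {a : A} (ha : a ∈ katsuraIdeal A X)
    (b : B) : elem a b ∈ katsuraIdeal (CStarTensor A B) (ExtTensor A X B Y) := by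
  refine elem_mem_of_dense isClosed_katsuraIdeal hl.left_full ?_ b
  rintro _ ⟨y, z, rfl⟩
  refine ⟨φ_elem_mem_compacts ha.1 (hl.φ_left y z), fun w hw => ?_⟩
  have h0 : ∀ (c : A) (u v : Y), elem a (l y z) * (w * elem c (l u v)) = 0 := fun c u v =>
    eq_zero_of_slice_eq_zero fun ω => by
      obtain ⟨ψ, hψ⟩ := exists_ip_φ_slice (A := A) (X := X) hl ω y z u v
      rw [slice_elem_mul, slice_mul_elem]
      refine ha.2 _ ?_
      rw [map_mul]
      convert zero_mul _
      ext x'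
      refine ext_ip (A := A) fun x => ?_
      rw [hψ, hw]
      simp
  have hcl : IsClosed ((LinearMap.ker (LinearMap.mulLeft ℂ (elem a (l y z) * w)) :
      Submodule ℂ (CStarTensor A B)) : Set (CStarTensor A B)) :=
    isClosed_eq (continuous_const.mul continuous_id) continuous_const
  -- By density `(a ⊗ b) w` annihilates all of `A ⊗ B`, in particular its own adjoint.
  refine (CStarRing.mul_star_self_eq_zero_iff _).1
    (mem_of_elem_mem hcl (fun c d => elem_mem_of_dense hcl hl.left_full ?_ d)
      (star (elem a (l y z) * w)))
  rintro _ ⟨u, v, rfl⟩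
  change elem a (l y z) * w * elem c (l u v) = 0
  rw [mul_assoc, h0]

end Katsura

end CStarCorrespondence

end

theorem mainTheorem5 {A X : Type u} {B Y : Type v}
    [NonUnitalCStarAlgebra A] [NonUnitalCStarAlgebra B]
    [NormedAddCommGroup X] [NormedSpace ℂ X] [CompleteSpace X]
    [NormedAddCommGroup Y] [NormedSpace ℂ Y] [CompleteSpace Y]
    [CStarCorrespondence.Correspondence A X] [CStarCorrespondence.Correspondence B Y]
    (hY : CStarCorrespondence.IsImprimitivityBimodule B Y)
    (hX : CStarCorrespondence.SliceMapProperty B (CStarCorrespondence.katsuraIdeal A X)) :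
    CStarCorrespondence.IdealCompatible A X B Y ∧
      CStarCorrespondence.katsuraIdeal (CStarCorrespondence.CStarTensor A B)
          (CStarCorrespondence.ExtTensor A X B Y)
        = CStarCorrespondence.tensorSub (CStarCorrespondence.katsuraIdeal A X) ⊤ := by
  obtain ⟨l, hl⟩ := hY
  have key : CStarCorrespondence.katsuraIdeal (CStarCorrespondence.CStarTensor A B)
      (CStarCorrespondence.ExtTensor A X B Y)
        = CStarCorrespondence.tensorSub (CStarCorrespondence.katsuraIdeal A X) ⊤ := by
    refine le_antisymm (fun x hx => ?_) ?_
    · rw [← SetLike.mem_coe, hX]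
      exact CStarCorrespondence.slice_mem_katsuraIdeal hl hx
    · refine Submodule.topologicalClosure_minimal _ (Submodule.span_le.2 ?_)
        CStarCorrespondence.isClosed_katsuraIdeal
      rintro _ ⟨a, ha, b, -, rfl⟩
      exact CStarCorrespondence.elem_mem_katsuraIdeal hl ha b
  refine ⟨?_, key⟩
  rw [CStarCorrespondence.IdealCompatible, hl.katsuraIdeal_eq_top]
  exact key
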